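/- Let $X_1,X_2,\dots$ be independent real random variables with common distribution $F$, having a finite and negative first moment, and let $S_0=0$, $S_n=X_1+\cdots+X_n$. Let $\tau=\min\{n\ge 1: S_n>0\}$ and $\tau_-=\min\{n\ge 1: S_n\le 0\}$ (with $\min\emptyset=\infty$). The strict ascending and weak descending ladder height distributions are the (possibly defective) distributions $F_+(x)=P\{S_\tau\le x,\ \tau<\infty\}$ and $F_-(x)=P\{S_{\tau_-}\le x,\ \tau_-<\infty\}$. For a possibly defective distribution function $G$ write $\overline G(x)=\lim_{t\to\infty}G(t)-G(x)$, and let $\mu_{F_-,1}=\int u\,dF_-(u)$. A measurable function $f$ is regularly varying of index $\rho$ if it is ultimately positive or ultimately negative and $f(\lambda t)/f(t)\to\lambda^{\rho}$ as $t\to\infty$ for every $\lambda>0$. Let $\omega>0$, and write $\omega=m+r$ with $m=\lfloor\omega\rfloor$ and $r\in[0,1)$. A measurable function $h$ is smoothly varying of index $\rho$ and order $\omega$ if it is ultimately $m$ times continuously differentiable, its $m$-th derivative $h^{(m)}$ is regularly varying of index $\rho-m$, and $$\lim_{\delta\to 0}\limsup_{t\to\infty}\sup_{0<|x|\le\delta}\left|\frac{h^{(m)}(t(1-x))-h^{(m)}(t)}{|x|^{r}\,h^{(m)}(t)}\right|=0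 .$$ **Lemma.** Let $\alpha>1$ and $\omega>0$, and suppose that $\overline F$ is smoothly varying of index $-\alpha$ and order $\omega$. Then $\overline F_+$ is smoothly varying of index $-\alpha+1$ and of the same order $\omega$. Moreover, $\mu_{F_-,1}$ is finite and, as $x\to\infty$, $$\overline F_+(x)\sim \frac{-1}{(\alpha-1)\,\mu_{F_-,1}}\;x\,\overline F(x).$$ -/

import Mathlib

open MeasureTheory ProbabilityTheory Filter Set
open scoped ENNReal Topology

namespace RandomWalkMax

/-! ### Regular and smooth variation at infinity -/

/-- A measurable real function `f` is regularly varying (at infinity) with index `ρ` if it is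
ultimately of constant strict sign and `f (l * t) / f t → l ^ ρ` as `t → ∞`, for every `l > 0`. -/
def RegularlyVarying (ρ : ℝ) (f : ℝ → ℝ) : Prop :=
  Measurable f ∧ ((∀ᶠ t in atTop, 0 < f t) ∨ (∀ᶠ t in atTop, f t < 0)) ∧
    ∀ l : ℝ, 0 < l → Tendsto (fun t => f (l * t) / f t) atTop (𝓝 (l ^ ρ))

/-- Smooth variation of index `ρ` and integer order `m`: `h` is ultimately `m` times continuously
differentiable and its `m`-th derivative is regularly varying with index `ρ - m`. -/
def SmoothlyVaryingNat (ρ : ℝ) (m : ℕ) (h : ℝ → ℝ) : Prop :=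
  Measurable h ∧ (∃ T : ℝ, ContDiffOn ℝ m h (Ioi T)) ∧
    RegularlyVarying (ρ - m) (iteratedDeriv m h)

/-- `Δ^r_{t,x}(h) = sign(x) (h(t(1-x)) - h(t)) / (|x|^r h(t))`. -/
noncomputable def relIncr (r t x : ℝ) (h : ℝ → ℝ) : ℝ :=
  Real.sign x * (h (t * (1 - x)) - h t) / (|x| ^ r * h t)

/-- Smooth variation of index `ρ` and real order `ω = m + r`, where `m = ⌊ω⌋` and `r ∈ [0, 1)`:
`h` is smoothly varying of index `ρ` and order `m` and
`lim_{δ → 0} limsup_{t → ∞} sup_{0 < |x| ≤ δ} |Δ^r_{t,x}(h^{(m)})| = 0`. The suprema and the upper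
limit are taken in `[0, ∞]`, so that they always exist. -/
def SmoothlyVarying (ρ ω : ℝ) (h : ℝ → ℝ) : Prop :=
  SmoothlyVaryingNat ρ ⌊ω⌋₊ h ∧
    Tendsto
      (fun δ : ℝ => limsup
        (fun t : ℝ => ⨆ (x : ℝ) (_ : 0 < |x| ∧ |x| ≤ δ),
          ENNReal.ofReal |relIncr (ω - ⌊ω⌋₊) t x (iteratedDeriv ⌊ω⌋₊ h)|) atTop)
      (𝓝[>] 0) (𝓝 0)

/-- The tail of a (possibly defective) distribution `G`, i.e. the function
`x ↦ lim_{t → ∞} G(t) - G(x)`, which is `x ↦ G((x, ∞))`. -/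
noncomputable def tail (G : Measure ℝ) (x : ℝ) : ℝ := G.real (Ioi x)

/-! ### Random walk and ladder heights -/

section Walk

variable {Ω : Type*} [MeasurableSpace Ω]

/-- The random walk `S_0 = 0`, `S_n = X_1 + ⋯ + X_n`; here the first increment is `X 0`. -/
def walk (X : ℕ → Ω → ℝ) (n : ℕ) (w : Ω) : ℝ := ∑ i ∈ Finset.range n, X i w

/-- The strict ascending ladder epoch `τ = min {n ≥ 1 : S_n > 0}`, equal to `⊤` if there is no
such `n`. -/
noncomputable def ascEpoch (X : ℕ → Ω → ℝ) : Ω → WithTop ℕ :=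
  hittingAfter (walk X) (Ioi 0) 1

/-- The weak descending ladder epoch `min {n ≥ 1 : S_n ≤ 0}`, equal to `⊤` if there is no
such `n`. -/
noncomputable def descEpoch (X : ℕ → Ω → ℝ) : Ω → WithTop ℕ :=
  hittingAfter (walk X) (Iic 0) 1

/-- The (possibly defective) law of the value of `S` at the random time `τ` on `{τ < ∞}`: the
measure `A ↦ P {S_τ ∈ A, τ < ∞}`. -/
noncomputable def stoppedLaw (P : Measure Ω) (X : ℕ → Ω → ℝ) (τ : Ω → WithTop ℕ) : Measure ℝ :=
  (P.restrict {w | τ w ≠ ⊤}).map (stoppedValue (walk X) τ)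

/-- The strict ascending ladder height distribution `F_+`. -/
noncomputable def ascLadder (P : Measure Ω) (X : ℕ → Ω → ℝ) : Measure ℝ :=
  stoppedLaw P X (ascEpoch X)

/-- The weak descending ladder height distribution `F_-`. -/
noncomputable def descLadder (P : Measure Ω) (X : ℕ → Ω → ℝ) : Measure ℝ :=
  stoppedLaw P X (descEpoch X)

end Walk

end RandomWalkMax

/-!
The tail of the ascending ladder height is a convolution of the tail of the step distribution:
the walk crosses `x ≥ 0` at its first ascent by jumping from a position `u ≤ 0` visited before that
ascent, so `F₊(x, ∞) = ∫ F(x + y, ∞) V(dy)`, where `V` is the occupation measure of the walk before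
its first ascent, reflected to `[0, ∞)` (`tail_hitLaw_Ioi`). Everything follows from the growth of
`V` and from a Karamata theorem for such convolutions.

Growth of `V`. Comparing the two ladder decompositions of the walk (`discPreHit_eq_renewal`), with
a discount factor `s < 1` in order to work with finite measures, yields the Wiener–Hopf identity
`U = δ₀ + U ∗ F₋` for the unreflected occupation measure `U`: it is the renewal measure of the
descending ladder heights. These have total mass one and a finite negative mean, since a Lyapunov
function bounds the expected descending epoch (`tsum_preHit_Iic_univ_ne_top`). Integrating the
renewal equation proves the elementary renewal theorem `V [0, y] ∼ y / |μ|`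
(`tendsto_renewal_div`). Linear growth at this coarse scale suffices, because smooth functions of
regular variation do not see the fine structure of `V`.

Convolution. Let `h` vary regularly with index `ρ < -1` and satisfy the Hölder condition of smooth
variation. On the cells `[x qᵏ, x qᵏ⁺¹)` with `q` near `1` the function `h` is nearly constant, so
`∫ h(x + y) V(dy)` is close to a sum over `k`, which dominated convergence evaluates
(`HolderRV.tendsto_integral_div`). The Hölder condition passes through the integral, since shifting
`t` to `t + y` shrinks relative increments (`HolderRV.integral`). Applied with Lebesgue measure in
place of `V`, the same theorem transfers regular variation from `h⁽ᵐ⁾` down to `h`; the resulting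
integrability permits differentiation under the integral, and the theorem applied to `h⁽ᵐ⁾` and
`V` gives smooth variation of the convolution (`SmoothlyVarying.of_eventually_eq_integral`).
-/

namespace RandomWalkMax

/-! ### The walk stopped at its first visit to a set -/

/-- The law of the position at time `n` of a random walk with step distribution `F`, on the event
that it has not visited `B` at times `1, …, n`. -/
noncomputable def preHit (F : Measure ℝ) (B : Set ℝ) : ℕ → Measure ℝ
  | 0 => Measure.dirac 0
  | n + 1 => (Measure.conv (preHit F B n) F).restrict Bᶜ

/-- The (possibly defective) law of the position of a random walk with step distribution `F` at the
time of its first visit to `B`. -/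
noncomputable def hitLaw (F : Measure ℝ) (B : Set ℝ) : Measure ℝ :=
  Measure.sum fun n => (Measure.conv (preHit F B n) F).restrict B

instance isFiniteMeasure_preHit (F : Measure ℝ) [IsFiniteMeasure F] (B : Set ℝ) (n : ℕ) :
    IsFiniteMeasure (preHit F B n) := by
  induction n with
  | zero => rw [preHit]; infer_instance
  | succ n ih => rw [preHit]; infer_instance

section Walk

variable {Ω : Type*}

/-- The event that the walk avoids `B` at times `1, …, n`. -/
def avoids (X : ℕ → Ω → ℝ) (B : Set ℝ) (n : ℕ) : Set Ω :=
  {w | ∀ j, 1 ≤ j → j ≤ n → walk X j w ∉ B}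

/-- The `σ`-algebra generated by the first `n` steps. -/
abbrev pastSteps (X : ℕ → Ω → ℝ) (n : ℕ) : MeasurableSpace Ω :=
  ⨆ i ∈ Iio n, MeasurableSpace.comap (X i) inferInstance

lemma measurable_walk_pastSteps (X : ℕ → Ω → ℝ) {j n : ℕ} (hj : j ≤ n) :
    Measurable[pastSteps X n] (walk X j) := by
  have : walk X j = fun w => ∑ i ∈ Finset.range j, X i w := rfl
  rw [this]
  refine @Finset.measurable_fun_sum _ _ _ _ _ _ (pastSteps X n) _ _ fun i hi => ?_
  exact (comap_measurable (X i)).mono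
    (le_iSup₂_of_le i ((Finset.mem_range.1 hi).trans_le hj) le_rfl) le_rfl

lemma measurableSet_avoids_pastSteps (X : ℕ → Ω → ℝ) {B : Set ℝ} (hB : MeasurableSet B) (n : ℕ) :
    MeasurableSet[pastSteps X n] (avoids X B n) := by
  simp only [avoids, ofPred_forall]
  exact MeasurableSet.iInter fun j => MeasurableSet.iInter fun _ => MeasurableSet.iInter fun hj =>
    (measurable_walk_pastSteps X hj hB).compl

variable [MeasurableSpace Ω]

lemma measurable_walk {X : ℕ → Ω → ℝ} (hX : ∀ i, Measurable (X i)) (n : ℕ) :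
    Measurable (walk X n) := by
  unfold walk; fun_prop

lemma measurableSet_avoids {X : ℕ → Ω → ℝ} (hX : ∀ i, Measurable (X i)) {B : Set ℝ}
    (hB : MeasurableSet B) (n : ℕ) : MeasurableSet (avoids X B n) := by
  simp only [avoids, ofPred_forall]
  exact MeasurableSet.iInter fun j => MeasurableSet.iInter fun _ => MeasurableSet.iInter fun _ =>
    (measurable_walk hX j hB).compl

/-- The next step is independent of the event `avoids X B n` and of the position `walk X n`, which
only depend on the first `n` steps. -/
lemma map_walk_succ {P : Measure Ω} [IsProbabilityMeasure P] {X : ℕ → Ω → ℝ}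
    (hX : ∀ i, Measurable (X i)) (hind : iIndepFun X P) {F : Measure ℝ}
    (hlaw : ∀ i, P.map (X i) = F) {B : Set ℝ} (hB : MeasurableSet B) (n : ℕ) :
    (P.restrict (avoids X B n)).map (walk X (n + 1)) =
      Measure.conv ((P.restrict (avoids X B n)).map (walk X n)) F := by
  have hF : IsProbabilityMeasure F := by
    rw [← hlaw 0]; exact Measure.isProbabilityMeasure_map (hX 0).aemeasurable
  have hwalk := measurable_walk_pastSteps X (le_refl n)
  have hE := measurableSet_avoids_pastSteps X hB n
  have hindep : Indep (pastSteps X n) (MeasurableSpace.comap (X n) inferInstance) P := by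
    have := indep_iSup_of_disjoint (fun i => (hX i).comap_le) hind
      (S := Iio n) (T := {n}) (by simp)
    simpa [pastSteps] using this
  have hpair : (P.restrict (avoids X B n)).map (fun w => (walk X n w, X n w)) =
      ((P.restrict (avoids X B n)).map (walk X n)).prod F := by
    symm
    refine Measure.prod_eq fun s t hs ht => ?_
    rw [Measure.map_apply ((measurable_walk hX n).prodMk (hX n)) (hs.prod ht),
      Measure.map_apply (measurable_walk hX n) hs,
      Measure.restrict_apply ((measurable_walk hX n).prodMk (hX n) (hs.prod ht)),
      Measure.restrict_apply (measurable_walk hX n hs), ← hlaw n, Measure.map_apply (hX n) ht]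
    have := (Indep_iff _ _ _).1 hindep _ _ (hE.inter (hwalk hs)) ⟨t, ht, rfl⟩
    rw [inter_comm (walk X n ⁻¹' s) (avoids X B n), ← this]
    congr 1
    ext w
    simp [and_comm, and_left_comm]
  rw [Measure.conv, ← hpair, Measure.map_map (by fun_prop)
    ((measurable_walk hX n).prodMk (hX n))]
  congr 1
  ext w
  simp [walk, Finset.sum_range_succ]

lemma map_walk_eq_preHit {P : Measure Ω} [IsProbabilityMeasure P] {X : ℕ → Ω → ℝ}
    (hX : ∀ i, Measurable (X i)) (hind : iIndepFun X P) {F : Measure ℝ}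
    (hlaw : ∀ i, P.map (X i) = F) {B : Set ℝ} (hB : MeasurableSet B) (n : ℕ) :
    (P.restrict (avoids X B n)).map (walk X n) = preHit F B n := by
  induction n with
  | zero =>
    have h0 : avoids X B 0 = univ := by
      ext w; simp only [avoids, mem_ofPred_eq, mem_univ, iff_true]; intro j h1 h2; omega
    have h1 : walk X 0 = fun _ => (0 : ℝ) := by ext w; simp [walk]
    rw [h0, h1, Measure.restrict_univ, Measure.map_const, preHit]
    simp
  | succ n ih =>
    rw [preHit, ← ih, ← map_walk_succ hX hind hlaw hB, Measure.restrict_map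
      (measurable_walk hX _) hB.compl, Measure.restrict_restrict
      (measurable_walk hX _ hB.compl)]
    congr 2
    ext w
    simp only [avoids, mem_ofPred_eq, mem_inter_iff, mem_preimage, mem_compl_iff]
    constructor
    · exact fun h => ⟨h _ (by omega) le_rfl, fun j h1 h2 => h j h1 (by omega)⟩
    · rintro ⟨h, h'⟩ j h1 h2
      rcases Nat.lt_or_ge j (n + 1) with h3 | h3
      · exact h' j h1 (by omega)
      · obtain rfl : j = n + 1 := by omega
        exact h

lemma stoppedLaw_hittingAfter {P : Measure Ω} [IsProbabilityMeasure P] {X : ℕ → Ω → ℝ}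
    (hX : ∀ i, Measurable (X i)) (hind : iIndepFun X P) {F : Measure ℝ}
    (hlaw : ∀ i, P.map (X i) = F) {B : Set ℝ} (hB : MeasurableSet B) :
    stoppedLaw P X (hittingAfter (walk X) B 1) = hitLaw F B := by
  set τ := hittingAfter (walk X) B 1 with hτ
  set A : ℕ → Set Ω := fun n => walk X (n + 1) ⁻¹' B ∩ avoids X B n with hA
  have hAm : ∀ n, MeasurableSet (A n) := fun n =>
    (measurable_walk hX _ hB).inter (measurableSet_avoids hX hB n)
  have hval : ∀ n w, w ∈ A n → τ w = WithTop.some (n + 1) := by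
    rintro n w ⟨h1, h2⟩
    refine le_antisymm (hittingAfter_le_of_mem (by omega) h1) ?_
    by_contra hlt
    rw [not_le] at hlt
    obtain ⟨j, hj, hjB⟩ := hittingAfter_lt_iff.1 hlt
    exact h2 j hj.1 (by have := hj.2; omega) hjB
  have hdisj : Pairwise (Function.onFun Disjoint A) := by
    intro i j hij
    refine Set.disjoint_left.2 fun w hi hj => hij ?_
    have := (hval i w hi).symm.trans (hval j w hj)
    have := WithTop.coe_injective this
    simpa using this
  have hunion : {w | τ w ≠ ⊤} = ⋃ n, A n := by
    ext w
    simp only [mem_ofPred_eq, mem_iUnion]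
    constructor
    · intro h
      rw [hτ, ne_eq, hittingAfter_eq_top_iff] at h
      push Not at h
      have hex : ∃ j, 1 ≤ j ∧ walk X j w ∈ B := h
      classical
      obtain ⟨h1, h2⟩ := Nat.find_spec hex
      refine ⟨Nat.find hex - 1, ?_, ?_⟩
      · rw [mem_preimage, Nat.sub_add_cancel h1]; exact h2
      · intro j hj1 hj2 hjB
        exact Nat.find_min hex (m := j) (by omega) ⟨hj1, hjB⟩
    · rintro ⟨n, hn⟩
      rw [hval n w hn]
      exact WithTop.coe_ne_top
  have hcongr : ∀ n, stoppedValue (walk X) τ =ᵐ[P.restrict (A n)] walk X (n + 1) := by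
    intro n
    filter_upwards [ae_restrict_mem (hAm n)] with w hw
    simp only [stoppedValue, hval n w hw]
    rfl
  have hae : ∀ n, AEMeasurable (stoppedValue (walk X) τ) (P.restrict (A n)) := fun n =>
    (measurable_walk hX (n + 1)).aemeasurable.congr (hcongr n).symm
  rw [stoppedLaw, hunion, Measure.restrict_iUnion hdisj hAm, Measure.map_sum
    (aemeasurable_sum_measure_iff.2 hae), hitLaw]
  congr 1
  ext1 n
  rw [Measure.map_congr (hcongr n), ← map_walk_eq_preHit hX hind hlaw hB n,
    ← map_walk_succ hX hind hlaw hB, Measure.restrict_map (measurable_walk hX _) hB,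
    Measure.restrict_restrict (measurable_walk hX _ hB)]

end Walk

/-! ### The renewal equation from the Wiener–Hopf factorization -/

lemma sum_conv {ι : Type*} (m : ι → Measure ℝ) (ν : Measure ℝ) [SFinite ν] :
    Measure.conv (Measure.sum m) ν = Measure.sum fun i => Measure.conv (m i) ν := by
  refine Measure.ext_of_lintegral _ fun f hf => ?_
  rw [lintegral_sum_measure, Measure.lintegral_conv hf, lintegral_sum_measure]
  exact tsum_congr fun i => (Measure.lintegral_conv hf).symm

lemma conv_sum {ι : Type*} [Countable ι] (m : ι → Measure ℝ) [∀ i, SFinite (m i)] (ν : Measure ℝ)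
    [SFinite ν] :
    Measure.conv ν (Measure.sum m) = Measure.sum fun i => Measure.conv ν (m i) := by
  rw [Measure.conv_comm, sum_conv]
  congr 1
  ext1 i
  rw [Measure.conv_comm]

lemma conv_apply (μ ν : Measure ℝ) [SFinite ν] {A : Set ℝ} (hA : MeasurableSet A) :
    Measure.conv μ ν A = ∫⁻ u, ν {v | u + v ∈ A} ∂μ := by
  rw [← lintegral_indicator_one hA, Measure.lintegral_conv (measurable_one.indicator hA)]
  refine lintegral_congr fun u => ?_
  have hm : MeasurableSet {v | u + v ∈ A} := (measurable_const_add u) hA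
  rw [← lintegral_indicator_one hm]
  rfl

/-- Monotone convergence, as `s ↑ 1`, for a sum discounted by powers of `s`. -/
lemma tsum_le_of_forall_pow_mul_le {ι : Type*} (c : ι → ℝ≥0∞) (k : ι → ℕ) (b : ℝ≥0∞)
    (h : ∀ s : ℝ≥0∞, s < 1 → ∑' i, s ^ k i * c i ≤ b) : ∑' i, c i ≤ b := by
  rw [ENNReal.tsum_eq_iSup_sum]
  refine iSup_le fun t => ?_
  have hlim : Tendsto (fun s : ℝ≥0∞ => ∑ i ∈ t, s ^ k i * c i) (𝓝[<] 1)
      (𝓝 (∑ i ∈ t, c i)) := by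
    refine tendsto_finsetSum _ fun i _ => ?_
    have h1 : Tendsto (fun s : ℝ≥0∞ => s ^ k i) (𝓝[<] 1) (𝓝 (1 ^ k i)) :=
      ((ENNReal.continuous_pow (k i)).tendsto 1).mono_left nhdsWithin_le_nhds
    rw [one_pow] at h1
    simpa using ENNReal.Tendsto.mul_const h1 (Or.inl one_ne_zero) (b := c i)
  have : (𝓝[<] (1 : ℝ≥0∞)).NeBot := by
    rw [← mem_closure_iff_nhdsWithin_neBot, closure_Iio' ⟨0, by simp⟩]
    simp
  refine le_of_tendsto hlim ?_
  filter_upwards [self_mem_nhdsWithin] with s hs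
  exact (ENNReal.sum_le_tsum t).trans (h s hs)

section Step

variable (F : Measure ℝ)

/-- The law of the walk before its first visit to `B`, summed over time with discount factor `s`. -/
noncomputable def discPreHit (B : Set ℝ) (s : ℝ≥0∞) : Measure ℝ :=
  Measure.sum fun n => s ^ n • preHit F B n

/-- The law of the walk at its first visit to `B`, with discount factor `s` for the time of the
visit. -/
noncomputable def discHit (B : Set ℝ) (s : ℝ≥0∞) : Measure ℝ :=
  Measure.sum fun n => s ^ (n + 1) • (Measure.conv (preHit F B n) F).restrict B

lemma preHit_univ_le [IsProbabilityMeasure F] (B : Set ℝ) (n : ℕ) : preHit F B n univ ≤ 1 := by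
  induction n with
  | zero => simp [preHit]
  | succ n ih =>
    rw [preHit]
    refine (Measure.restrict_apply_le _ _).trans ?_
    rw [conv_apply _ _ MeasurableSet.univ]
    simpa using ih

/-- A walk that has avoided `B` up to some time either still avoids it after one more step or visits
it for the first time then; this is the discounted sum over time of that alternative. -/
lemma discPreHit_add_discHit [IsProbabilityMeasure F] {B : Set ℝ} (hB : MeasurableSet B)
    (s : ℝ≥0∞) :
    discPreHit F B s + discHit F B s =
      Measure.dirac 0 + s • Measure.conv (discPreHit F B s) F := by
  ext A hA
  rw [discPreHit, sum_conv]
  simp only [discHit, Measure.add_apply, Measure.sum_apply _ hA, Measure.smul_apply, smul_eq_mul,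
    Measure.conv_smul_left]
  rw [tsum_eq_zero_add' ENNReal.summable, add_assoc, ← ENNReal.tsum_add, ← ENNReal.tsum_mul_left]
  congr 1
  · simp [preHit]
  · refine tsum_congr fun n => ?_
    rw [preHit, ← mul_add, Measure.restrict_apply hA, Measure.restrict_apply hA, ← sdiff_eq,
      add_comm (Measure.conv _ _ (A \ B)), measure_inter_add_sdiff A hB, pow_succ', mul_assoc]

lemma isFiniteMeasure_discPreHit [IsProbabilityMeasure F] (B : Set ℝ) {s : ℝ≥0∞} (hs : s < 1) :
    IsFiniteMeasure (discPreHit F B s) := by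
  refine ⟨?_⟩
  rw [discPreHit, Measure.sum_apply _ MeasurableSet.univ]
  calc ∑' n, (s ^ n • preHit F B n) univ ≤ ∑' n, s ^ n := by
        refine ENNReal.tsum_le_tsum fun n => ?_
        simpa using mul_le_mul_right (preHit_univ_le F B n) (s ^ n)
    _ = (1 - s)⁻¹ := ENNReal.tsum_geometric s
    _ < ∞ := by simp [hs]

lemma isFiniteMeasure_discHit [IsProbabilityMeasure F] {B : Set ℝ} (hB : MeasurableSet B)
    {s : ℝ≥0∞} (hs : s < 1) :
    IsFiniteMeasure (discHit F B s) := by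
  have := isFiniteMeasure_discPreHit F B hs
  refine ⟨?_⟩
  have h := congrArg (fun m => m univ) (discPreHit_add_discHit F hB s)
  simp only [Measure.add_apply, Measure.smul_apply, smul_eq_mul] at h
  refine (le_add_self.trans h.le).trans_lt ?_
  exact ENNReal.add_lt_top.2 ⟨measure_lt_top _ _,
    ENNReal.mul_lt_top (hs.trans ENNReal.one_lt_top) (measure_lt_top _ _)⟩

lemma preHit_succ_apply_of_subset {B A : Set ℝ} (hA : MeasurableSet A) (hAB : A ⊆ B) (n : ℕ) :
    preHit F B (n + 1) A = 0 := by
  rw [preHit, Measure.restrict_apply hA]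
  have : A ∩ Bᶜ = ∅ := by
    ext x; simp only [mem_inter_iff, mem_compl_iff, mem_empty_iff_false, iff_false]
    exact fun h => h.2 (hAB h.1)
  simp [this]

lemma preHit_Ioi_apply_Ioi (n : ℕ) : preHit F (Ioi 0) n (Ioi 0) = 0 := by
  cases n with
  | zero => simp [preHit]
  | succ n => exact preHit_succ_apply_of_subset F measurableSet_Ioi subset_rfl n

lemma preHit_Iic_apply_Iio (n : ℕ) : preHit F (Iic 0) n (Iio 0) = 0 := by
  cases n with
  | zero => simp [preHit]
  | succ n => exact preHit_succ_apply_of_subset F measurableSet_Iio Iio_subset_Iic_self n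

/-- The Wiener–Hopf identity for finite measures: both ladder decompositions factor the same
measure `δ - s F`, and comparing the parts on the negative half-line identifies the discounted
occupation measure before the first ascent as the renewal measure of the descending ladder
heights. -/
lemma discPreHit_eq_renewal [IsProbabilityMeasure F] {s : ℝ≥0∞} (hs : s < 1)
    {A : Set ℝ} (hA : MeasurableSet A) (hA0 : A ⊆ Iic 0) :
    discPreHit F (Ioi 0) s A = Measure.dirac 0 A +
      Measure.conv (discPreHit F (Ioi 0) s) (discHit F (Iic 0) s) A := by
  have hU := discPreHit_add_discHit F (measurableSet_Ioi (a := (0 : ℝ))) s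
  have hW := discPreHit_add_discHit F (measurableSet_Iic (a := (0 : ℝ))) s
  have i1 := isFiniteMeasure_discPreHit F (Ioi 0) hs
  have i2 := isFiniteMeasure_discPreHit F (Iic 0) hs
  have i3 := isFiniteMeasure_discHit F (measurableSet_Ioi (a := (0 : ℝ))) hs
  have i4 := isFiniteMeasure_discHit F (measurableSet_Iic (a := (0 : ℝ))) hs
  have hWA : discPreHit F (Iic 0) s A = Measure.dirac 0 A := by
    rw [discPreHit, Measure.sum_apply _ hA, tsum_eq_single 0]
    · simp [preHit]
    · intro n hn
      obtain ⟨k, rfl⟩ := Nat.exists_eq_succ_of_ne_zero hn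
      simp [preHit_succ_apply_of_subset F hA hA0 k]
  have hW0 : discPreHit F (Iic 0) s (Iio 0) = 0 := by
    rw [discPreHit, Measure.sum_apply _ measurableSet_Iio]
    simp [preHit_Iic_apply_Iio]
  have hg0 : discHit F (Ioi 0) s (Iic 0) = 0 := by
    rw [discHit, Measure.sum_apply _ measurableSet_Iic]
    simp [Measure.restrict_apply measurableSet_Iic, Iic_inter_Ioi]
  have hWg : Measure.conv (discPreHit F (Iic 0) s) (discHit F (Ioi 0) s) A = 0 := by
    rw [conv_apply _ _ hA, lintegral_eq_zero_iff' ]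
    · have : ∀ᵐ u ∂discPreHit F (Iic 0) s, u ∉ Iio (0 : ℝ) := measure_eq_zero_iff_ae_notMem.1 hW0
      filter_upwards [this] with u hu
      refine measure_mono_null (fun v hv => ?_) hg0
      have h1 : u + v ≤ 0 := hA0 hv
      have h2 : 0 ≤ u := not_lt.1 hu
      exact mem_Iic.2 (by linarith)
    · have := (measurable_measure_prodMk_left (ν := discHit F (Ioi 0) s)
        (measurable_add hA : MeasurableSet ((fun p : ℝ × ℝ => p.1 + p.2) ⁻¹' A)))
      exact this.aemeasurable
  generalize discPreHit F (Ioi 0) s = U at *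
  generalize discPreHit F (Iic 0) s = W at *
  generalize discHit F (Ioi 0) s = g at *
  generalize discHit F (Iic 0) s = f at *
  have e1 : Measure.conv U W + Measure.conv U f = U + s • Measure.conv U (Measure.conv W F) := by
    rw [← Measure.conv_add, hW, Measure.conv_comm, Measure.add_conv, Measure.dirac_zero_conv,
      Measure.conv_smul_left, Measure.conv_comm (Measure.conv W F)]
  have e2 : Measure.conv U W + Measure.conv W g = W + s • Measure.conv U (Measure.conv W F) := by
    rw [Measure.conv_comm U W, ← Measure.conv_add, hU, Measure.conv_comm, Measure.add_conv,
      Measure.dirac_zero_conv, Measure.conv_smul_left, Measure.conv_assoc, Measure.conv_comm F W]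
  have e1A := congrArg (fun m => m A) e1
  have e2A := congrArg (fun m => m A) e2
  simp only [Measure.add_apply, hWg, add_zero, hWA] at e1A e2A
  set r := (s • Measure.conv U (Measure.conv W F)) A with hr
  have hrt : r ≠ ∞ := by
    have : r ≤ Measure.conv U W A := by rw [e2A]; exact le_add_self
    exact (this.trans_lt (measure_lt_top _ _)).ne
  rw [e2A] at e1A
  have : r + (Measure.dirac 0 A + Measure.conv U f A) = r + U A := by
    rw [← add_assoc, add_comm r, e1A, add_comm]
  exact ((ENNReal.add_right_inj hrt).1 this).symm

/-- The occupation measure of the walk before its first visit to `(0, ∞)`: the expected number of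
visits to a set, with time `0` included. -/
noncomputable def occupation : Measure ℝ := Measure.sum fun n => preHit F (Ioi 0) n

lemma occupation_Ioi : occupation F (Ioi 0) = 0 := by
  rw [occupation, Measure.sum_apply _ measurableSet_Ioi]
  simp [preHit_Ioi_apply_Ioi]

instance [IsProbabilityMeasure F] : SFinite (occupation F) := by unfold occupation; infer_instance

instance [IsProbabilityMeasure F] (B : Set ℝ) : SFinite (hitLaw F B) := by
  unfold hitLaw; infer_instance

instance [IsProbabilityMeasure F] (B : Set ℝ) (s : ℝ≥0∞) : SFinite (discPreHit F B s) := by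
  unfold discPreHit; infer_instance

instance [IsProbabilityMeasure F] (B : Set ℝ) (s : ℝ≥0∞) : SFinite (discHit F B s) := by
  unfold discHit; infer_instance

lemma hitLaw_compl {B : Set ℝ} (hB : MeasurableSet B) : hitLaw F B Bᶜ = 0 := by
  rw [hitLaw, Measure.sum_apply _ hB.compl]
  simp [Measure.restrict_apply hB.compl]

lemma hitLaw_Iic_Ioi : hitLaw F (Iic 0) (Ioi 0) = 0 := by
  rw [← compl_Iic]; exact hitLaw_compl F measurableSet_Iic

lemma discHit_le {B : Set ℝ} {s : ℝ≥0∞} (hs : s ≤ 1) : discHit F B s ≤ hitLaw F B := by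
  refine Measure.le_iff.2 fun A hA => ?_
  rw [discHit, hitLaw, Measure.sum_apply _ hA, Measure.sum_apply _ hA]
  refine ENNReal.tsum_le_tsum fun n => ?_
  simpa using mul_le_mul_left (pow_le_one₀ (zero_le) hs : s ^ (n + 1) ≤ 1) _

lemma measurable_hitLaw_Iio_sub (B : Set ℝ) (y : ℝ) :
    Measurable fun u : ℝ => hitLaw F B (Iio (-y - u)) := by
  have : Antitone fun u : ℝ => hitLaw F B (Iio (-y - u)) := fun a b hab =>
    measure_mono (Iio_subset_Iio (by linarith))
  exact this.measurable

lemma setLIntegral_Iio_add_Ici (h1 : hitLaw F (Iic 0) univ = 1) (m : Measure ℝ) (y : ℝ) :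
    (∫⁻ u in Icc (-y) 0, hitLaw F (Iic 0) (Iio (-y - u)) ∂m) +
      ∫⁻ u in Icc (-y) 0, hitLaw F (Iic 0) (Ici (-y - u)) ∂m = m (Icc (-y) 0) := by
  rw [← lintegral_add_left (measurable_hitLaw_Iio_sub F _ y)]
  have : ∀ u, hitLaw F (Iic 0) (Iio (-y - u)) + hitLaw F (Iic 0) (Ici (-y - u)) = 1 := fun u => by
    rw [← h1, ← compl_Iio, measure_add_measure_compl measurableSet_Iio]
  simp [this]

/-- For a measure on the negative half-line, the descending ladder height leads from a point of
`[-y, 0]` to a point of `[-y, 0]` exactly when it does not jump below `-y`. -/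
lemma conv_hitLaw_Icc [IsProbabilityMeasure F] {m : Measure ℝ} (hm : m (Ioi 0) = 0) {y : ℝ} :
    Measure.conv m (hitLaw F (Iic 0)) (Icc (-y) 0) =
      ∫⁻ u in Icc (-y) 0, hitLaw F (Iic 0) (Ici (-y - u)) ∂m := by
  rw [conv_apply _ _ measurableSet_Icc, ← lintegral_indicator measurableSet_Icc]
  refine lintegral_congr_ae ?_
  have : ∀ᵐ u ∂m, u ∉ Ioi (0 : ℝ) := measure_eq_zero_iff_ae_notMem.1 hm
  have hf : ∀ᵐ v ∂hitLaw F (Iic 0), v ∉ Ioi (0 : ℝ) :=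
    measure_eq_zero_iff_ae_notMem.1 (hitLaw_Iic_Ioi F)
  filter_upwards [this] with u hu
  rw [mem_Ioi, not_lt] at hu
  by_cases huy : u ∈ Icc (-y) 0
  · rw [indicator_of_mem huy]
    refine measure_congr ?_
    filter_upwards [hf] with v hv
    rw [mem_Ioi, not_lt] at hv
    simp only [eq_iff_iff]
    change (-y ≤ u + v ∧ u + v ≤ 0) ↔ -y - u ≤ v
    constructor
    · intro h; linarith [h.1]
    · intro h; constructor <;> linarith
  · rw [indicator_of_notMem huy]
    refine measure_mono_null (fun v hv => ?_) (hitLaw_Iic_Ioi F)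
    by_contra hv0
    rw [mem_Ioi, not_lt] at hv0
    have h1 : -y ≤ u + v := hv.1
    exact huy ⟨by linarith, hu⟩

lemma discPreHit_Ioi_Ioi (s : ℝ≥0∞) : discPreHit F (Ioi 0) s (Ioi 0) = 0 := by
  rw [discPreHit, Measure.sum_apply _ measurableSet_Ioi]
  simp [preHit_Ioi_apply_Ioi]

lemma conv_mono_right (m : Measure ℝ) {f g : Measure ℝ} [SFinite f] [SFinite g] (h : f ≤ g) :
    Measure.conv m f ≤ Measure.conv m g := by
  refine Measure.le_iff.2 fun A hA => ?_
  rw [conv_apply _ _ hA, conv_apply _ _ hA]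
  exact lintegral_mono fun u => h _

/-- Upper half of the renewal equation: the expected number of descending ladder heights in
`[-y, 0]` from which the next one falls below `-y` is at most one. The discounted measures are
finite, so the renewal equation may be subtracted there before the discount is removed. -/
lemma lintegral_overshoot_le_one [IsProbabilityMeasure F] (h1 : hitLaw F (Iic 0) univ = 1) (y : ℝ) :
    ∫⁻ u in Icc (-y) 0, hitLaw F (Iic 0) (Iio (-y - u)) ∂occupation F ≤ 1 := by
  rw [occupation, Measure.restrict_sum _ measurableSet_Icc, lintegral_sum_measure]
  refine tsum_le_of_forall_pow_mul_le _ (fun n => n) _ fun s hs => ?_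
  have hfin := isFiniteMeasure_discPreHit F (Ioi 0) hs
  have hsum : ∑' n, s ^ n * ∫⁻ u in Icc (-y) 0, hitLaw F (Iic 0) (Iio (-y - u))
      ∂preHit F (Ioi 0) n = ∫⁻ u in Icc (-y) 0, hitLaw F (Iic 0) (Iio (-y - u))
      ∂discPreHit F (Ioi 0) s := by
    rw [discPreHit, Measure.restrict_sum _ measurableSet_Icc, lintegral_sum_measure]
    simp [Measure.restrict_smul, lintegral_smul_measure]
  rw [hsum]
  have hA := setLIntegral_Iio_add_Ici F h1 (discPreHit F (Ioi 0) s) y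
  have hB : discPreHit F (Ioi 0) s (Icc (-y) 0) ≤
      1 + ∫⁻ u in Icc (-y) 0, hitLaw F (Iic 0) (Ici (-y - u)) ∂discPreHit F (Ioi 0) s := by
    rw [← conv_hitLaw_Icc F (discPreHit_Ioi_Ioi F s),
      discPreHit_eq_renewal F hs measurableSet_Icc (fun x hx => hx.2)]
    exact add_le_add prob_le_one (conv_mono_right _ (discHit_le F hs.le) _)
  have hne : ∫⁻ u in Icc (-y) 0, hitLaw F (Iic 0) (Ici (-y - u)) ∂discPreHit F (Ioi 0) s ≠ ∞ := by
    refine (lt_of_le_of_lt ?_ (measure_lt_top (discPreHit F (Ioi 0) s) (Icc (-y) 0))).ne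
    rw [← hA]; exact le_add_self
  rw [← hA] at hB
  exact (ENNReal.add_le_add_iff_right hne).1 hB

lemma dirac_add_conv_occupation_le [IsProbabilityMeasure F] {A : Set ℝ}
    (hA : MeasurableSet A) (hA0 : A ⊆ Iic 0) :
    Measure.dirac 0 A + Measure.conv (occupation F) (hitLaw F (Iic 0)) A ≤ occupation F A := by
  have hocc : occupation F A = Measure.dirac 0 A + ∑' n, preHit F (Ioi 0) (n + 1) A := by
    rw [occupation, Measure.sum_apply _ hA, tsum_eq_zero_add' ENNReal.summable, preHit]
  rw [hocc]
  refine add_le_add le_rfl ?_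
  have hconv : Measure.conv (occupation F) (hitLaw F (Iic 0)) A =
      ∑' p : ℕ × ℕ, Measure.conv (preHit F (Ioi 0) p.1)
        ((Measure.conv (preHit F (Iic 0) p.2) F).restrict (Iic 0)) A := by
    rw [ENNReal.tsum_prod', occupation, sum_conv, Measure.sum_apply _ hA]
    refine tsum_congr fun i => ?_
    rw [hitLaw, conv_sum, Measure.sum_apply _ hA]
  rw [hconv]
  refine tsum_le_of_forall_pow_mul_le _ (fun p => p.1 + (p.2 + 1)) _ fun s hs => ?_
  have hren := discPreHit_eq_renewal F hs hA hA0
  have hU : discPreHit F (Ioi 0) s A =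
      Measure.dirac 0 A + ∑' n, s ^ (n + 1) * preHit F (Ioi 0) (n + 1) A := by
    rw [discPreHit, Measure.sum_apply _ hA, tsum_eq_zero_add' ENNReal.summable]
    simp [preHit]
  have hUf : Measure.conv (discPreHit F (Ioi 0) s) (discHit F (Iic 0) s) A =
      ∑' p : ℕ × ℕ, s ^ (p.1 + (p.2 + 1)) * Measure.conv (preHit F (Ioi 0) p.1)
        ((Measure.conv (preHit F (Iic 0) p.2) F).restrict (Iic 0)) A := by
    rw [ENNReal.tsum_prod', discPreHit, sum_conv, Measure.sum_apply _ hA]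
    refine tsum_congr fun i => ?_
    rw [discHit, conv_sum, Measure.sum_apply _ hA]
    refine tsum_congr fun j => ?_
    rw [Measure.conv_smul_left, Measure.conv_comm, Measure.conv_smul_left, Measure.conv_comm]
    simp [pow_add, mul_assoc]
  rw [hU, hUf] at hren
  rw [← (ENNReal.add_right_inj (measure_ne_top _ _)).1 hren]
  refine ENNReal.tsum_le_tsum fun n => ?_
  simpa using mul_le_mul_left (pow_le_one₀ (zero_le) hs.le : s ^ (n + 1) ≤ 1) _

/-- Lower half of the renewal equation, where finiteness of the mass of `[-y, 0]` is needed to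
subtract. -/
lemma one_le_lintegral_overshoot [IsProbabilityMeasure F] (h1 : hitLaw F (Iic 0) univ = 1)
    {y : ℝ} (hy : 0 ≤ y) (hfin : occupation F (Icc (-y) 0) ≠ ∞) :
    1 ≤ ∫⁻ u in Icc (-y) 0, hitLaw F (Iic 0) (Iio (-y - u)) ∂occupation F := by
  have hA := setLIntegral_Iio_add_Ici F h1 (occupation F) y
  have hB := dirac_add_conv_occupation_le F (A := Icc (-y) 0) measurableSet_Icc (fun x hx => hx.2)
  rw [conv_hitLaw_Icc F (occupation_Ioi F), ← hA,
    Measure.dirac_apply' _ measurableSet_Icc, indicator_of_mem (by simpa using hy)] at hB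
  have hne : ∫⁻ u in Icc (-y) 0, hitLaw F (Iic 0) (Ici (-y - u)) ∂occupation F ≠ ∞ := by
    refine (lt_of_le_of_lt ?_ hfin.lt_top).ne
    rw [← hA]; exact le_add_self
  exact (ENNReal.add_le_add_iff_right hne).1 hB

end Step

/-! ### The descending ladder height of a walk with negative drift -/

/-- Truncating a law of negative mean far enough from below keeps its mean negative. -/
lemma exists_truncated_mean_neg {F : Measure ℝ} (hint : Integrable (fun x : ℝ => x) F)
    (hmean : ∫ x, x ∂F < 0) :
    ∃ c : ℝ, 0 < c ∧ Integrable (fun x : ℝ => max x (-c)) F ∧ ∫ x, max x (-c) ∂F < 0 := by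
  have hlim : Tendsto (fun n : ℕ => ∫ x, max x (-(n : ℝ)) ∂F) atTop (𝓝 (∫ x, x ∂F)) := by
    refine tendsto_integral_of_dominated_convergence (fun x => |x|)
      (fun n => (measurable_id.max measurable_const).aestronglyMeasurable) hint.abs
      (fun n => ae_of_all _ fun x => ?_) (ae_of_all _ fun x => ?_)
    · have : (0 : ℝ) ≤ n := n.cast_nonneg
      rw [Real.norm_eq_abs, abs_le]
      constructor
      · exact (neg_abs_le x).trans (le_max_left _ _)
      · exact max_le (le_abs_self x) (by linarith [abs_nonneg x])
    · refine tendsto_const_nhds.congr' ?_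
      obtain ⟨N, hN⟩ := exists_nat_ge (-x)
      filter_upwards [eventually_ge_atTop N] with n hn
      have : (N : ℝ) ≤ n := by exact_mod_cast hn
      rw [max_eq_left (by linarith)]
  obtain ⟨n, hn, hn1⟩ := ((hlim.eventually_lt_const hmean).and (eventually_ge_atTop 1)).exists
  refine ⟨n, by exact_mod_cast hn1, ?_, hn⟩
  refine hint.abs.mono' (measurable_id.max measurable_const).aestronglyMeasurable
    (ae_of_all _ fun x => ?_)
  have : (0 : ℝ) ≤ n := n.cast_nonneg
  rw [Real.norm_eq_abs, abs_le]
  constructor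
  · exact (neg_abs_le x).trans (le_max_left _ _)
  · exact max_le (le_abs_self x) (by linarith [abs_nonneg x])

lemma preHit_Iic_ae_nonneg (F : Measure ℝ) (n : ℕ) : ∀ᵐ u ∂preHit F (Iic 0) n, 0 ≤ u := by
  have : ∀ᵐ u ∂preHit F (Iic 0) n, u ∉ Iio (0 : ℝ) :=
    measure_eq_zero_iff_ae_notMem.1 (preHit_Iic_apply_Iio F n)
  filter_upwards [this] with u hu using not_lt.1 hu

section Ladder

variable {F : Measure ℝ} [IsProbabilityMeasure F]

/-- The expected descending ladder epoch is finite. The Lyapunov function is `u ↦ u + c` on the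
positive half-line; truncating the steps at `-c` keeps it nonnegative up to the crossing. -/
lemma tsum_preHit_Iic_univ_ne_top (hint : Integrable (fun x : ℝ => x) F)
    (hmean : ∫ x, x ∂F < 0) : ∑' n, preHit F (Iic 0) n univ ≠ ∞ := by
  obtain ⟨c, hc, hci, hcm⟩ := exists_truncated_mean_neg hint hmean
  set a := -∫ x, max x (-c) ∂F with ha
  have ha0 : 0 < a := by linarith
  set φ : ℝ → ℝ≥0∞ := fun x => ENNReal.ofReal (x + c) with hφ
  have hφm : Measurable φ := by fun_prop
  have hstep : ∀ u : ℝ, 0 ≤ u →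
      (∫⁻ x, (Ioi 0).indicator φ (u + x) ∂F) + ENNReal.ofReal a ≤ φ u := by
    intro u hu
    have hnn : ∀ x : ℝ, 0 ≤ u + c + max x (-c) := fun x => by linarith [le_max_right x (-c)]
    have hle : ∫⁻ x, (Ioi 0).indicator φ (u + x) ∂F ≤
        ENNReal.ofReal (∫ x, (u + c + max x (-c)) ∂F) := by
      have hi : Integrable (fun x : ℝ => u + c + max x (-c)) F := (integrable_const _).add hci
      rw [ofReal_integral_eq_lintegral_ofReal hi (ae_of_all _ hnn)]
      refine lintegral_mono fun x => ?_
      refine (indicator_le_self' (fun _ _ => zero_le) _).trans ?_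
      exact ENNReal.ofReal_le_ofReal (by linarith [le_max_left x (-c)])
    have hval : ∫ x, (u + c + max x (-c)) ∂F = u + c - a := by
      rw [integral_add (integrable_const _) hci, integral_const]
      simp [ha]
    have hua : 0 ≤ u + c - a := by rw [← hval]; exact integral_nonneg hnn
    rw [hval] at hle
    refine (add_le_add hle le_rfl).trans ?_
    rw [← ENNReal.ofReal_add hua ha0.le]
    exact ENNReal.ofReal_le_ofReal (by linarith)
  have hdrift : ∀ n, (∫⁻ u, φ u ∂preHit F (Iic 0) (n + 1)) +
      ENNReal.ofReal a * preHit F (Iic 0) n univ ≤ ∫⁻ u, φ u ∂preHit F (Iic 0) n := by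
    intro n
    rw [preHit, compl_Iic, ← lintegral_indicator measurableSet_Ioi,
      Measure.lintegral_conv (hφm.indicator measurableSet_Ioi), ← lintegral_const,
      ← lintegral_add_right _ measurable_const]
    refine lintegral_mono_ae ?_
    filter_upwards [preHit_Iic_ae_nonneg F n] with u hu using hstep u hu
  have hsum : ∀ N, (∫⁻ u, φ u ∂preHit F (Iic 0) N) +
      ∑ n ∈ Finset.range N, ENNReal.ofReal a * preHit F (Iic 0) n univ ≤ ENNReal.ofReal c := by
    intro N
    induction N with
    | zero => simp [preHit, hφ]
    | succ N ih =>
      rw [Finset.sum_range_succ, add_comm (∑ n ∈ _, _), ← add_assoc]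
      exact (add_le_add (hdrift N) le_rfl).trans ih
  have htsum : ENNReal.ofReal a * ∑' n, preHit F (Iic 0) n univ ≤ ENNReal.ofReal c := by
    rw [← ENNReal.tsum_mul_left]
    refine ENNReal.tsum_le_of_sum_range_le fun N => ?_
    exact le_add_self.trans (hsum N)
  intro htop
  rw [htop, ENNReal.mul_top (by simpa using ha0)] at htsum
  exact absurd htsum (by simp)

lemma hitLaw_Iic_univ (hint : Integrable (fun x : ℝ => x) F) (hmean : ∫ x, x ∂F < 0) :
    hitLaw F (Iic 0) univ = 1 := by
  have hfin := tsum_preHit_Iic_univ_ne_top hint hmean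
  have hlim := ENNReal.tendsto_atTop_zero_of_tsum_ne_top hfin
  have hsplit : ∀ n, (Measure.conv (preHit F (Iic 0) n) F).restrict (Iic 0) univ +
      preHit F (Iic 0) (n + 1) univ = preHit F (Iic 0) n univ := by
    intro n
    rw [preHit, Measure.restrict_apply_univ, Measure.restrict_apply_univ,
      measure_add_measure_compl measurableSet_Iic, conv_apply _ _ MeasurableSet.univ]
    simp
  have hsum : ∀ N, (∑ n ∈ Finset.range N,
      (Measure.conv (preHit F (Iic 0) n) F).restrict (Iic 0) univ) +
        preHit F (Iic 0) N univ = 1 := by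
    intro N
    induction N with
    | zero => simp [preHit]
    | succ N ih => rw [Finset.sum_range_succ, add_assoc, hsplit, ih]
  have h1 := (ENNReal.summable (f := fun n =>
    (Measure.conv (preHit F (Iic 0) n) F).restrict (Iic 0) univ)).hasSum.tendsto_sum_nat
  rw [hitLaw, Measure.sum_apply _ MeasurableSet.univ]
  have h2 := h1.add hlim
  simp only [hsum, add_zero] at h2
  exact (tendsto_nhds_unique tendsto_const_nhds h2).symm

lemma integrable_hitLaw_Iic (hint : Integrable (fun x : ℝ => x) F) (hmean : ∫ x, x ∂F < 0) :
    Integrable (fun x : ℝ => x) (hitLaw F (Iic 0)) := by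
  refine ⟨measurable_id.aestronglyMeasurable, ?_⟩
  rw [HasFiniteIntegral, hitLaw, lintegral_sum_measure]
  have hterm : ∀ n, ∫⁻ u, ‖u‖ₑ ∂(Measure.conv (preHit F (Iic 0) n) F).restrict (Iic 0) ≤
      (∫⁻ x, ‖x‖ₑ ∂F) * preHit F (Iic 0) n univ := by
    intro n
    rw [← lintegral_indicator measurableSet_Iic,
      Measure.lintegral_conv (measurable_enorm.indicator measurableSet_Iic), ← lintegral_const]
    refine lintegral_mono_ae ?_
    filter_upwards [preHit_Iic_ae_nonneg F n] with u hu
    refine lintegral_mono fun x => ?_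
    refine indicator_apply_le' (fun h => ?_) (fun _ => zero_le)
    have h' : u + x ≤ 0 := h
    rw [Real.enorm_eq_ofReal_abs, Real.enorm_eq_ofReal_abs]
    refine ENNReal.ofReal_le_ofReal ?_
    rw [abs_of_nonpos h', abs_of_nonpos (by linarith)]
    linarith
  refine (ENNReal.tsum_le_tsum hterm).trans_lt ?_
  rw [ENNReal.tsum_mul_left]
  exact ENNReal.mul_lt_top hint.2 (tsum_preHit_Iic_univ_ne_top hint hmean).lt_top

lemma integral_hitLaw_Iic_neg (hint : Integrable (fun x : ℝ => x) F) (hmean : ∫ x, x ∂F < 0) :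
    ∫ x, x ∂hitLaw F (Iic 0) < 0 := by
  have hnn : 0 ≤ᵐ[hitLaw F (Iic 0)] fun x : ℝ => -x := by
    have : ∀ᵐ v ∂hitLaw F (Iic 0), v ∉ Ioi (0 : ℝ) :=
      measure_eq_zero_iff_ae_notMem.1 (hitLaw_Iic_Ioi F)
    filter_upwards [this] with v hv
    rw [mem_Ioi, not_lt] at hv
    simpa using hv
  have hF : F (Iio 0) ≠ 0 := by
    intro h0
    have : ∀ᵐ x ∂F, x ∉ Iio (0 : ℝ) := measure_eq_zero_iff_ae_notMem.1 h0
    have : 0 ≤ ∫ x, x ∂F := integral_nonneg_of_ae (by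
      filter_upwards [this] with x hx using not_lt.1 hx)
    linarith
  have hle : F (Iio 0) ≤ hitLaw F (Iic 0) (Iio 0) := by
    rw [hitLaw, Measure.sum_apply _ measurableSet_Iio]
    refine le_trans ?_ (ENNReal.le_tsum 0)
    rw [preHit, Measure.dirac_zero_conv, Measure.restrict_apply measurableSet_Iio,
      inter_eq_left.2 Iio_subset_Iic_self]
  have hpos : 0 < ∫ x, -x ∂hitLaw F (Iic 0) := by
    rw [integral_pos_iff_support_of_nonneg_ae hnn (integrable_hitLaw_Iic hint hmean).neg]
    refine (pos_iff_ne_zero.2 hF).trans_le (hle.trans (measure_mono fun x hx => ?_))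
    simpa using (ne_of_lt hx : x ≠ 0)
  rw [integral_neg] at hpos
  linarith

end Ladder

/-! ### The elementary renewal theorem -/

/-- The elementary renewal theorem for a measure `V` on the half-line that satisfies the renewal
equation with jump law `G`, in its overshoot form. Integrating the equation over `[0, z]` gives
`z = ∫ m(z - v) V(dv)`, where `m(s)`, the integrated tail of `G`, increases to the mean of `G`. -/
theorem tendsto_renewal_div {V G : Measure ℝ} [SFinite V] [IsProbabilityMeasure G] {μ : ℝ}
    (hμ : 0 < μ) (hGμ : ∫⁻ x, ENNReal.ofReal x ∂G = ENNReal.ofReal μ) (hG0 : G (Iio 0) = 0)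
    (hle : ∀ y, ∫⁻ v in Icc 0 y, G (Ioi (y - v)) ∂V ≤ 1)
    (hge : ∀ y, 0 ≤ y → V (Icc 0 y) ≠ ∞ → 1 ≤ ∫⁻ v in Icc 0 y, G (Ioi (y - v)) ∂V) :
    (∀ y, V (Icc 0 y) ≠ ∞) ∧
      Tendsto (fun y => V.real (Icc 0 y) / y) atTop (𝓝 (1 / μ)) := by
  set g : ℝ → ℝ≥0∞ := (Ici 0).indicator fun t => G (Ioi t) with hg
  have hgm : Measurable g := by
    refine Measurable.indicator ?_ measurableSet_Ici
    have : Antitone fun t : ℝ => G (Ioi t) := fun a b hab => measure_mono (Ioi_subset_Ioi hab)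
    exact this.measurable
  set m : ℝ → ℝ≥0∞ := fun s => ∫⁻ t in Iic s, g t with hm
  have hmmono : Monotone m := fun a b hab => lintegral_mono_set (Iic_subset_Iic.2 hab)
  have htot : ∫⁻ t, g t = ENNReal.ofReal μ := by
    have h0 : 0 ≤ᵐ[G] fun x : ℝ => x := by
      have : ∀ᵐ v ∂G, v ∉ Iio (0 : ℝ) := measure_eq_zero_iff_ae_notMem.1 hG0
      filter_upwards [this] with v hv using not_lt.1 hv
    rw [← hGμ, lintegral_eq_lintegral_meas_lt G h0 aemeasurable_id, hg,
      lintegral_indicator measurableSet_Ici, ← setLIntegral_congr Ioi_ae_eq_Ici]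
    rfl
  have hmlim : Tendsto m atTop (𝓝 (ENNReal.ofReal μ)) := by
    have := tendsto_measure_Iic_atTop (volume.withDensity g)
    rw [withDensity_apply _ MeasurableSet.univ, Measure.restrict_univ, htot] at this
    exact this.congr fun s => withDensity_apply _ measurableSet_Iic
  have hmle : ∀ s, m s ≤ ENNReal.ofReal μ := fun s => by
    rw [← htot]; exact setLIntegral_le_lintegral _ _
  have hm0 : ∀ s, s < 0 → m s = 0 := by
    intro s hs
    refine (setLIntegral_congr_fun measurableSet_Iic fun t ht => ?_).trans lintegral_zero
    exact indicator_of_notMem (fun h => by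
      have h1 : 0 ≤ t := h
      have h2 : t ≤ s := ht
      linarith) _
  -- the overshoot probabilities at level `y`, written as a convolution with `g`
  have hconv : ∀ y, ∫⁻ v in Icc 0 y, G (Ioi (y - v)) ∂V = ∫⁻ v in Ici 0, g (y - v) ∂V := by
    intro y
    rw [← lintegral_indicator measurableSet_Icc, ← lintegral_indicator measurableSet_Ici]
    refine lintegral_congr fun v => ?_
    by_cases h0 : 0 ≤ v
    · by_cases h1 : v ≤ y
      · rw [indicator_of_mem (show v ∈ Icc 0 y from ⟨h0, h1⟩),
          indicator_of_mem (show v ∈ Ici 0 from h0), hg,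
          indicator_of_mem (show y - v ∈ Ici 0 from sub_nonneg.2 h1)]
      · rw [indicator_of_notMem (show v ∉ Icc 0 y from fun h => h1 h.2),
          indicator_of_mem (show v ∈ Ici 0 from h0), hg,
          indicator_of_notMem (show y - v ∉ Ici 0 from fun h => h1 (sub_nonneg.1 h))]
    · rw [indicator_of_notMem (show v ∉ Icc 0 y from fun h => h0 h.1),
        indicator_of_notMem (show v ∉ Ici 0 from h0)]
  have hfub : ∀ z, ∫⁻ y in Icc 0 z, ∫⁻ v in Icc 0 y, G (Ioi (y - v)) ∂V =
      ∫⁻ v in Ici 0, m (z - v) ∂V := by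
    intro z
    simp only [hconv]
    rw [lintegral_lintegral_swap (by fun_prop)]
    refine setLIntegral_congr_fun measurableSet_Ici fun v hv => ?_
    have hv : 0 ≤ v := hv
    simp only [hm]
    rw [← lintegral_indicator measurableSet_Icc, ← lintegral_indicator measurableSet_Iic,
      ← lintegral_sub_right_eq_self ((Iic (z - v)).indicator g) v]
    refine lintegral_congr fun y => ?_
    by_cases h0 : 0 ≤ y
    · by_cases h1 : y ≤ z
      · rw [indicator_of_mem (show y ∈ Icc 0 z from ⟨h0, h1⟩),
          indicator_of_mem (show y - v ∈ Iic (z - v) from by simpa using h1)]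
      · rw [indicator_of_notMem (show y ∉ Icc 0 z from fun h => h1 h.2),
          indicator_of_notMem (show y - v ∉ Iic (z - v) from by simpa using h1)]
    · have : g (y - v) = 0 := indicator_of_notMem (fun h => by
        have h' : 0 ≤ y - v := h
        linarith) _
      rw [indicator_of_notMem (show y ∉ Icc 0 z from fun h => h0 h.1), indicator_apply, this]
      simp
  have hvol : ∀ z : ℝ, ∫⁻ _ in Icc 0 z, (1 : ℝ≥0∞) = ENNReal.ofReal z := fun z => by simp
  have hup : ∀ w z, m (z - w) * V (Icc 0 w) ≤ ENNReal.ofReal z := by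
    intro w z
    calc m (z - w) * V (Icc 0 w) = ∫⁻ v in Icc 0 w, m (z - w) ∂V := by simp
      _ ≤ ∫⁻ v in Icc 0 w, m (z - v) ∂V :=
          setLIntegral_mono' measurableSet_Icc fun v hv => hmmono (by linarith [hv.2])
      _ ≤ ∫⁻ v in Ici 0, m (z - v) ∂V := lintegral_mono_set Icc_subset_Ici_self
      _ = ∫⁻ y in Icc 0 z, ∫⁻ v in Icc 0 y, G (Ioi (y - v)) ∂V := (hfub z).symm
      _ ≤ ∫⁻ _ in Icc 0 z, (1 : ℝ≥0∞) := lintegral_mono fun y => hle y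
      _ = ENNReal.ofReal z := hvol z
  have hfin : ∀ y, V (Icc 0 y) ≠ ∞ := by
    intro y htop
    obtain ⟨s, hs⟩ := (hmlim.eventually_const_lt
      (show (0 : ℝ≥0∞) < ENNReal.ofReal μ by simpa using hμ)).exists
    have := hup y (y + s)
    rw [add_sub_cancel_left, htop, ENNReal.mul_top hs.ne'] at this
    exact absurd this (by simp)
  have hlow : ∀ z, 0 ≤ z → ENNReal.ofReal z ≤ ENNReal.ofReal μ * V (Icc 0 z) := by
    intro z hz
    calc ENNReal.ofReal z = ∫⁻ _ in Icc 0 z, (1 : ℝ≥0∞) := (hvol z).symm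
      _ ≤ ∫⁻ y in Icc 0 z, ∫⁻ v in Icc 0 y, G (Ioi (y - v)) ∂V :=
          setLIntegral_mono' measurableSet_Icc fun y hy => hge y hy.1 (hfin y)
      _ = ∫⁻ v in Ici 0, m (z - v) ∂V := hfub z
      _ = ∫⁻ v in Icc 0 z, m (z - v) ∂V := by
          rw [← lintegral_indicator measurableSet_Icc, ← lintegral_indicator measurableSet_Ici]
          refine lintegral_congr fun v => ?_
          by_cases h1 : v ≤ z
          · simp [indicator_apply, h1]
          · simp [indicator_apply, h1, hm0 (z - v) (by linarith)]
      _ ≤ ∫⁻ v in Icc 0 z, ENNReal.ofReal μ ∂V := lintegral_mono fun v => hmle _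
      _ = ENNReal.ofReal μ * V (Icc 0 z) := by simp
  refine ⟨hfin, tendsto_order.2 ⟨fun a ha => ?_, fun b hb => ?_⟩⟩
  · filter_upwards [eventually_gt_atTop 0] with y hy
    refine ha.trans_le ?_
    have := ENNReal.toReal_mono (ENNReal.mul_ne_top ENNReal.ofReal_ne_top (hfin y)) (hlow y hy.le)
    rw [ENNReal.toReal_mul, ENNReal.toReal_ofReal hy.le, ENNReal.toReal_ofReal hμ.le] at this
    rw [div_le_div_iff₀ hμ hy, one_mul, mul_comm]
    exact this
  · set l := (1 + b * μ) / 2 with hl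
    have hbμ : 1 < b * μ := (div_lt_iff₀ hμ).1 hb
    have hl1 : 1 < l := by rw [hl]; linarith
    have hlb : l / μ < b := by rw [div_lt_iff₀ hμ, hl]; linarith
    have hmr : Tendsto (fun y => l / (m ((l - 1) * y)).toReal) atTop (𝓝 (l / μ)) := by
      have h1 : Tendsto (fun y => (l - 1) * y) atTop atTop :=
        tendsto_id.const_mul_atTop (by linarith)
      have h2 := (ENNReal.tendsto_toReal ENNReal.ofReal_ne_top).comp (hmlim.comp h1)
      rw [ENNReal.toReal_ofReal hμ.le] at h2
      exact tendsto_const_nhds.div h2 hμ.ne'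
    have hmpos : ∀ᶠ y in atTop, 0 < m ((l - 1) * y) :=
      (hmlim.comp (tendsto_id.const_mul_atTop (show 0 < l - 1 by linarith))).eventually_const_lt
        (by simpa using hμ)
    filter_upwards [eventually_gt_atTop 0, hmr.eventually_lt_const hlb, hmpos] with y hy h1 h2
    refine lt_of_le_of_lt ?_ h1
    have h3 : (0 : ℝ) < (m ((l - 1) * y)).toReal :=
      ENNReal.toReal_pos h2.ne' ((hmle _).trans_lt ENNReal.ofReal_lt_top).ne
    have := ENNReal.toReal_mono ENNReal.ofReal_ne_top (hup y (l * y))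
    rw [ENNReal.toReal_mul, ENNReal.toReal_ofReal (by positivity),
      show l * y - y = (l - 1) * y by ring] at this
    rw [div_le_div_iff₀ hy h3, mul_comm]
    exact this

/-! ### Convolving a regularly varying function with a measure of linear growth -/

/-- Regular variation of index `ρ` together with a multiplicative Hölder condition of exponent `r`:
the smooth variation condition on the top derivative, in `ε`-`δ` form. -/
structure HolderRV (ρ r : ℝ) (h : ℝ → ℝ) : Prop where
  sign : (∀ᶠ t in atTop, 0 < h t) ∨ (∀ᶠ t in atTop, h t < 0)
  ratio : ∀ l : ℝ, 0 < l → Tendsto (fun t => h (l * t) / h t) atTop (𝓝 (l ^ ρ))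
  holder : ∀ ε : ℝ, 0 < ε → ∃ δ : ℝ, 0 < δ ∧ ∀ᶠ t in atTop, ∀ x : ℝ, |x| ≤ δ →
    |h (t * (1 - x)) - h t| ≤ ε * |x| ^ r * |h t|

/-- A measure on `[0, ∞)` with `V [0, y] ∼ κ y`. -/
structure HasLinearGrowth (V : Measure ℝ) (κ : ℝ) : Prop where
  pos : 0 < κ
  Iio_zero : V (Iio 0) = 0
  finite : ∀ y, V (Icc 0 y) ≠ ∞
  tendsto : Tendsto (fun y => V.real (Icc 0 y) / y) atTop (𝓝 κ)

lemma eventually_eventuallyEq_nhds_of_atTop {p : ℝ → Prop} (h : ∀ᶠ x in atTop, p x) :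
    ∀ᶠ x : ℝ in atTop, ∀ᶠ z in 𝓝 x, p z := by
  obtain ⟨T, hT⟩ := eventually_atTop.1 h
  filter_upwards [eventually_gt_atTop T] with x hx
  filter_upwards [Ioi_mem_nhds hx] with z hz using hT z (le_of_lt hz)

lemma eventually_forall_ge {p : ℝ → Prop} (h : ∀ᶠ x in atTop, p x) :
    ∀ᶠ x : ℝ in atTop, ∀ z, x ≤ z → p z := by
  obtain ⟨T, hT⟩ := eventually_atTop.1 h
  filter_upwards [eventually_ge_atTop T] with x hx z hz using hT z (hx.trans hz)

namespace HolderRV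

variable {ρ r : ℝ} {h : ℝ → ℝ}

lemma neg (hh : HolderRV ρ r h) : HolderRV ρ r (fun t => -h t) where
  sign := by
    rcases hh.sign with h1 | h1
    · exact Or.inr (h1.mono fun t ht => neg_lt_zero.2 ht)
    · exact Or.inl (h1.mono fun t ht => neg_pos.2 ht)
  ratio l hl := by simpa [neg_div_neg_eq] using hh.ratio l hl
  holder ε hε := by
    obtain ⟨δ, hδ, H⟩ := hh.holder ε hε
    refine ⟨δ, hδ, H.mono fun t ht x hx => ?_⟩
    have := ht x hx
    rwa [abs_neg, neg_sub_neg, abs_sub_comm]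

lemma congr {g : ℝ → ℝ} (hh : HolderRV ρ r h) (hg : ∀ᶠ t in atTop, g t = h t) :
    HolderRV ρ r g where
  sign := by
    rcases hh.sign with h1 | h1
    · exact Or.inl (by filter_upwards [h1, hg] with t ht e; rwa [e])
    · exact Or.inr (by filter_upwards [h1, hg] with t ht e; rwa [e])
  ratio l hl := by
    refine (hh.ratio l hl).congr' ?_
    filter_upwards [hg, (tendsto_id.const_mul_atTop hl).eventually hg] with t e1 e2
    simp only [id] at e2
    rw [e1, e2]
  holder ε hε := by
    obtain ⟨δ, hδ, H⟩ := hh.holder ε hε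
    refine ⟨min δ (1 / 2), by positivity, ?_⟩
    filter_upwards [H, hg, (tendsto_id.atTop_div_const (show (0 : ℝ) < 2 by norm_num)).eventually
      (eventually_forall_ge hg), eventually_ge_atTop 0] with t h1 e1 e2 ht x hx
    have hx1 := hx.trans (min_le_left _ _)
    have hx2 := (abs_le.1 (hx.trans (min_le_right _ _))).2
    rw [e1, e2 (t * (1 - x)) (by simp only [id]; nlinarith)]
    exact h1 x hx1

/-- Uniform continuity on a multiplicative scale. -/
lemma exists_abs_sub_le (hh : HolderRV ρ r h) (hr : 0 ≤ r) {ε : ℝ} (hε : 0 < ε) :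
    ∃ δ : ℝ, 0 < δ ∧ ∀ᶠ t in atTop, ∀ x : ℝ, |x| ≤ δ → |h (t * (1 - x)) - h t| ≤ ε * |h t| := by
  obtain ⟨δ, hδ, H⟩ := hh.holder ε hε
  refine ⟨min δ 1, by positivity, H.mono fun t ht x hx =>
    (ht x (hx.trans (min_le_left _ _))).trans ?_⟩
  refine mul_le_mul_of_nonneg_right ?_ (abs_nonneg _)
  have : |x| ^ r ≤ 1 := Real.rpow_le_one (abs_nonneg _) (hx.trans (min_le_right _ _)) hr
  nlinarith

end HolderRV

namespace HasLinearGrowth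

variable {V : Measure ℝ} {κ : ℝ}

lemma ae_nonneg (hV : HasLinearGrowth V κ) : ∀ᵐ y ∂V, 0 ≤ y := by
  have : ∀ᵐ y ∂V, y ∉ Iio (0 : ℝ) := measure_eq_zero_iff_ae_notMem.1 hV.Iio_zero
  filter_upwards [this] with y hy using not_lt.1 fun h => hy h

lemma measure_Ico_ne_top (hV : HasLinearGrowth V κ) (a b : ℝ) : V (Ico a b) ≠ ∞ := by
  have : V (Ico a b) ≤ V (Iio 0) + V (Icc 0 b) := by
    refine (measure_mono fun x hx => ?_).trans (measure_union_le _ _)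
    rcases lt_or_ge x 0 with h | h
    · exact Or.inl h
    · exact Or.inr ⟨h, hx.2.le⟩
  rw [hV.Iio_zero, zero_add] at this
  exact (this.trans_lt (hV.finite b).lt_top).ne

lemma tendsto_Ico (hV : HasLinearGrowth V κ) :
    Tendsto (fun y => V.real (Ico 0 y) / y) atTop (𝓝 κ) := by
  have hlow : Tendsto (fun y => V.real (Icc 0 (y - 1)) / (y - 1) * ((y - 1) / y)) atTop (𝓝 κ) := by
    have h1 : Tendsto (fun y : ℝ => y - 1) atTop atTop :=
      tendsto_atTop_add_const_right _ _ tendsto_id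
    have h2 : Tendsto (fun y : ℝ => (y - 1) / y) atTop (𝓝 1) := by
      have : Tendsto (fun y : ℝ => 1 - y⁻¹) atTop (𝓝 (1 - 0)) :=
        tendsto_const_nhds.sub tendsto_inv_atTop_zero
      rw [sub_zero] at this
      refine this.congr' ?_
      filter_upwards [eventually_gt_atTop 0] with y hy
      field_simp
    simpa using (hV.tendsto.comp h1).mul h2
  refine tendsto_of_tendsto_of_tendsto_of_le_of_le' hlow hV.tendsto ?_ ?_
  · filter_upwards [eventually_gt_atTop 1] with y hy
    rw [div_mul_div_cancel₀ (by linarith)]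
    refine div_le_div_of_nonneg_right (measureReal_mono (fun x hx => ?_)
      (hV.measure_Ico_ne_top _ _)) (by linarith)
    exact ⟨hx.1, by linarith [hx.2]⟩
  · filter_upwards [eventually_gt_atTop 0] with y hy
    exact div_le_div_of_nonneg_right (measureReal_mono Ico_subset_Icc_self (hV.finite _)) hy.le

lemma tendsto_Ico_mul_div (hV : HasLinearGrowth V κ) {c : ℝ} (hc : 0 ≤ c) :
    Tendsto (fun x => V.real (Ico 0 (x * c)) / x) atTop (𝓝 (κ * c)) := by
  rcases hc.eq_or_lt with rfl | hc
  · simp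
  · have := (hV.tendsto_Ico.comp (tendsto_id.atTop_mul_const hc)).mul_const c
    refine this.congr' ?_
    filter_upwards [eventually_gt_atTop 0] with x hx
    simp only [Function.comp, id]
    field_simp

lemma real_Ico (hV : HasLinearGrowth V κ) {a b : ℝ} (ha : 0 ≤ a) (hab : a ≤ b) :
    V.real (Ico a b) = V.real (Ico 0 b) - V.real (Ico 0 a) := by
  have : Ico 0 b = Ico 0 a ∪ Ico a b := (Ico_union_Ico_eq_Ico ha hab).symm
  rw [this, measureReal_union (Set.disjoint_left.2 fun x h1 h2 => not_lt.2 h2.1 h1.2)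
    measurableSet_Ico (hV.measure_Ico_ne_top _ _) (hV.measure_Ico_ne_top _ _)]
  ring

end HasLinearGrowth

/-- The cells `[x (q ^ k - 1), x (q ^ (k + 1) - 1))`, chosen so that `x + y` runs through
`[x q ^ k, x q ^ (k + 1))`. -/
def geomCell (q x : ℝ) (k : ℕ) : Set ℝ := Ico (x * (q ^ k - 1)) (x * (q ^ (k + 1) - 1))

lemma iUnion_geomCell {q x : ℝ} (hq : 1 < q) (hx : 0 < x) : ⋃ k, geomCell q x k = Ici 0 := by
  ext y
  simp only [mem_iUnion, mem_Ici, geomCell, mem_Ico]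
  constructor
  · rintro ⟨k, hk, -⟩
    refine le_trans ?_ hk
    exact mul_nonneg hx.le (sub_nonneg.2 (one_le_pow₀ hq.le))
  · intro hy
    obtain ⟨n, hn1, hn2⟩ := exists_nat_pow_near (x := 1 + y / x) (y := q)
      (by have : 0 ≤ y / x := by positivity
          linarith) hq
    have e : x * (y / x) = y := by field_simp
    exact ⟨n, by nlinarith, by nlinarith⟩

lemma pairwise_disjoint_geomCell {q x : ℝ} (hq : 1 < q) (hx : 0 < x) :
    Pairwise (Function.onFun Disjoint (geomCell q x)) := by
  have key : ∀ i j, i < j → Disjoint (geomCell q x i) (geomCell q x j) := by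
    intro i j hij
    refine Set.disjoint_left.2 fun y h1 h2 => ?_
    have : q ^ (i + 1) ≤ q ^ j := pow_le_pow_right₀ hq.le hij
    have h3 := h1.2
    have h4 := h2.1
    nlinarith
  intro i j hij
  rcases lt_or_gt_of_ne hij with h | h
  · exact key i j h
  · exact (key j i h).symm

/-- Comparison of `∫ h(x + y) V(dy)` with a sum over geometric cells, for a positive function `h`
that is nearly constant on each cell and decays geometrically from cell to cell. -/
lemma integral_geomCell_bounds {V : Measure ℝ} {κ : ℝ} (hV : HasLinearGrowth V κ) {h : ℝ → ℝ}
    (hm : Measurable h) {q a C ε x : ℝ} (hq : 1 < q) (ha : 0 ≤ a) (haq : a * q < 1) (hx : 0 < x)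
    (hpos : ∀ t, x ≤ t → 0 < h t) (hdec : ∀ t, x ≤ t → h (q * t) ≤ a * h t)
    (hcell : ∀ t, x ≤ t → ∀ s, t ≤ s → s ≤ q * t → |h s - h t| ≤ ε * h t)
    (hC : ∀ y, x ≤ y → V.real (Ico 0 y) ≤ C * y) :
    (∀ k, h (x * q ^ k) * V.real (geomCell q x k) ≤ h x * x * C * q * (a * q) ^ k) ∧
    Integrable (fun y => h (x + y)) V ∧
    (1 - ε) * ∑' k, h (x * q ^ k) * V.real (geomCell q x k) ≤ ∫ y, h (x + y) ∂V ∧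
    ∫ y, h (x + y) ∂V ≤ (1 + ε) * ∑' k, h (x * q ^ k) * V.real (geomCell q x k) := by
  have hq0 : 0 < q := by linarith
  have hxk : ∀ k : ℕ, x ≤ x * q ^ k := fun k => le_mul_of_one_le_right hx.le (one_le_pow₀ hq.le)
  have hdeck : ∀ k : ℕ, h (x * q ^ k) ≤ a ^ k * h x := by
    intro k
    induction k with
    | zero => simp
    | succ k ih =>
      have := hdec _ (hxk k)
      rw [show x * q ^ (k + 1) = q * (x * q ^ k) by ring, pow_succ']
      exact this.trans (by rw [mul_assoc]; exact mul_le_mul_of_nonneg_left ih ha)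
  have hb : ∀ k, h (x * q ^ k) * V.real (geomCell q x k) ≤ h x * x * C * q * (a * q) ^ k := by
    intro k
    have h1 : V.real (geomCell q x k) ≤ C * (x * q ^ (k + 1)) := by
      refine le_trans (measureReal_mono (fun y hy => ?_) (hV.measure_Ico_ne_top _ _))
        (hC _ (hxk (k + 1)))
      refine ⟨le_trans (mul_nonneg hx.le (sub_nonneg.2 (one_le_pow₀ hq.le))) hy.1, ?_⟩
      have := hy.2
      nlinarith
    calc h (x * q ^ k) * V.real (geomCell q x k)
        ≤ (a ^ k * h x) * (C * (x * q ^ (k + 1))) :=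
          mul_le_mul (hdeck k) h1 measureReal_nonneg
            (mul_nonneg (pow_nonneg ha k) (hpos x le_rfl).le)
      _ = h x * x * C * q * (a * q) ^ k := by rw [mul_pow]; ring
  have hsum : Summable fun k => h (x * q ^ k) * V.real (geomCell q x k) := by
    refine Summable.of_nonneg_of_le
      (fun k => mul_nonneg (hpos _ (hxk k)).le measureReal_nonneg) hb ?_
    exact (summable_geometric_of_lt_one (by positivity) haq).mul_left _
  have hmem : ∀ k, ∀ y ∈ geomCell q x k, |h (x + y) - h (x * q ^ k)| ≤ ε * h (x * q ^ k) := by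
    intro k y hy
    have h1 := hy.1
    have h2 := hy.2
    refine hcell _ (hxk k) _ (by nlinarith) ?_
    rw [pow_succ'] at h2
    nlinarith
  have hcm : ∀ k, MeasurableSet (geomCell q x k) := fun k => measurableSet_Ico
  have hcf : ∀ k, V (geomCell q x k) < ∞ := fun k => (hV.measure_Ico_ne_top _ _).lt_top
  have hmx : Measurable fun y => h (x + y) := hm.comp (measurable_const_add x)
  have hik : ∀ k, IntegrableOn (fun y => h (x + y)) (geomCell q x k) V := by
    intro k
    refine Measure.integrableOn_of_bounded (M := (1 + ε) * h (x * q ^ k)) (hcf k).ne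
      hmx.aestronglyMeasurable ?_
    filter_upwards [ae_restrict_mem (hcm k)] with y hy
    have h1 := hmem k y hy
    have h2 := hpos _ (hxk k)
    rw [Real.norm_eq_abs]
    have h3 : |h (x + y)| ≤ |h (x + y) - h (x * q ^ k)| + |h (x * q ^ k)| := by
      simpa using abs_add_le (h (x + y) - h (x * q ^ k)) (h (x * q ^ k))
    rw [abs_of_pos h2] at h3
    linarith
  have hconst : ∀ (k : ℕ) (c : ℝ), ∫ _ in geomCell q x k, c ∂V = V.real (geomCell q x k) * c := by
    intro k c
    rw [setIntegral_const, smul_eq_mul]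
  have hconsti : ∀ (k : ℕ) (c : ℝ), IntegrableOn (fun _ => c) (geomCell q x k) V := fun k c =>
    integrableOn_const (hcf k).ne
  have hlow : ∀ k, (1 - ε) * (h (x * q ^ k) * V.real (geomCell q x k)) ≤
      ∫ y in geomCell q x k, h (x + y) ∂V := by
    intro k
    rw [show (1 - ε) * (h (x * q ^ k) * V.real (geomCell q x k)) =
      V.real (geomCell q x k) * ((1 - ε) * h (x * q ^ k)) by ring, ← hconst]
    refine setIntegral_mono_on (hconsti _ _) (hik k) (hcm k) fun y hy => ?_
    have := (abs_le.1 (hmem k y hy)).1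
    linarith
  have hup : ∀ k, ∫ y in geomCell q x k, h (x + y) ∂V ≤
      (1 + ε) * (h (x * q ^ k) * V.real (geomCell q x k)) := by
    intro k
    rw [show (1 + ε) * (h (x * q ^ k) * V.real (geomCell q x k)) =
      V.real (geomCell q x k) * ((1 + ε) * h (x * q ^ k)) by ring, ← hconst]
    refine setIntegral_mono_on (hik k) (hconsti _ _) (hcm k) fun y hy => ?_
    have := (abs_le.1 (hmem k y hy)).2
    linarith
  have hposc : ∀ k, ∀ y ∈ geomCell q x k, 0 < h (x + y) := fun k y hy => by
    refine hpos _ ?_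
    have : y ∈ Ici (0 : ℝ) := by rw [← iUnion_geomCell hq hx]; exact mem_iUnion.2 ⟨k, hy⟩
    have : 0 ≤ y := this
    linarith
  have hon : IntegrableOn (fun y => h (x + y)) (⋃ k, geomCell q x k) V := by
    refine integrableOn_iUnion_of_summable_integral_norm hik ?_
    refine Summable.of_nonneg_of_le (fun k => integral_nonneg fun y => norm_nonneg _)
      (fun k => ?_) (hsum.mul_left (1 + ε))
    refine le_trans (le_of_eq ?_) (hup k)
    refine setIntegral_congr_fun (hcm k) fun y hy => ?_
    exact Real.norm_of_nonneg (hposc k y hy).le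
  have hHS := hasSum_integral_iUnion hcm (pairwise_disjoint_geomCell hq hx) hon
  rw [iUnion_geomCell hq hx] at hHS hon
  have hres : V.restrict (Ici 0) = V := Measure.restrict_eq_self_of_ae_mem hV.ae_nonneg
  rw [IntegrableOn, hres] at hon
  rw [hres] at hHS
  refine ⟨hb, hon, ?_, ?_⟩
  · rw [← tsum_mul_left, ← hHS.tsum_eq]
    exact (hsum.mul_left _).tsum_le_tsum hlow hHS.summable
  · rw [← tsum_mul_left, ← hHS.tsum_eq]
    exact hHS.summable.tsum_le_tsum hup (hsum.mul_left _)

/-- Riemann sum approximation along the geometric cells of ratio `q`: dominated convergence for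
series evaluates the sum, and the mesh `q - 1` controls the relative error. -/
lemma HolderRV.exists_geometric_sandwich {V : Measure ℝ} {κ ρ r : ℝ} {h : ℝ → ℝ}
    (hV : HasLinearGrowth V κ) (hm : Measurable h) (hh : HolderRV ρ r h) (hr : 0 ≤ r) (hρ : ρ < -1)
    (hpos : ∀ᶠ t in atTop, 0 < h t) {ε : ℝ} (hε : 0 < ε) :
    ∃ q₀ : ℝ, 1 < q₀ ∧ ∀ q, 1 < q → q ≤ q₀ →
      (∀ᶠ x in atTop, Integrable (fun y => h (x + y)) V) ∧
      ∃ S : ℝ → ℝ, Tendsto S atTop (𝓝 (κ * ((q - 1) / (1 - q ^ (ρ + 1))))) ∧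
        ∀ᶠ x in atTop, (1 - ε) * S x ≤ (∫ y, h (x + y) ∂V) / (x * h x) ∧
          (∫ y, h (x + y) ∂V) / (x * h x) ≤ (1 + ε) * S x := by
  obtain ⟨δ, hδ, Hδ⟩ := hh.exists_abs_sub_le hr hε
  refine ⟨1 + δ, by linarith, fun q hq hqδ => ?_⟩
  have hq0 : 0 < q := by linarith
  -- any decay rate strictly between `ρ` and `-1` gives a summable bound
  set p := (ρ - 1) / 2 with hp
  set a := q ^ p with ha
  have ha0 : 0 < a := Real.rpow_pos_of_pos hq0 _
  have haq : a * q < 1 := by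
    rw [ha, ← Real.rpow_add_one hq0.ne']
    exact Real.rpow_lt_one_of_one_lt_of_neg hq (by rw [hp]; linarith)
  have hdec : ∀ᶠ t in atTop, h (q * t) ≤ a * h t := by
    have hlt : q ^ ρ < a := Real.rpow_lt_rpow_of_exponent_lt hq (by rw [hp]; linarith)
    filter_upwards [(hh.ratio q hq0).eventually_lt_const hlt, hpos] with t h1 h2
    exact ((div_lt_iff₀ h2).1 h1).le
  have hcell : ∀ᶠ t in atTop, ∀ s, t ≤ s → s ≤ q * t → |h s - h t| ≤ ε * h t := by
    filter_upwards [Hδ, hpos, eventually_gt_atTop 0] with t h1 h2 ht s hs1 hs2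
    have h3 := h1 (1 - s / t) (by
      rw [abs_sub_comm, abs_of_nonneg (by rw [sub_nonneg, le_div_iff₀ ht]; linarith)]
      have : s / t ≤ q := by rw [div_le_iff₀ ht]; exact hs2
      linarith)
    rw [show t * (1 - (1 - s / t)) = s by field_simp; ring, abs_of_pos h2] at h3
    exact h3
  have hC : ∀ᶠ y in atTop, V.real (Ico 0 y) ≤ (κ + 1) * y := by
    filter_upwards [hV.tendsto_Ico.eventually_lt_const (show κ < κ + 1 by linarith),
      eventually_gt_atTop 0] with y h1 hy
    exact ((div_lt_iff₀ hy).1 h1).le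
  have hall := ((eventually_gt_atTop (0 : ℝ)).and ((eventually_forall_ge hpos).and
    ((eventually_forall_ge hdec).and ((eventually_forall_ge hcell).and
      (eventually_forall_ge hC))))).mono fun x hx =>
    integral_geomCell_bounds hV hm hq ha0.le haq hx.1 hx.2.1 hx.2.2.1 hx.2.2.2.1 hx.2.2.2.2
  refine ⟨hall.mono fun x hx => hx.2.1,
    fun x => ∑' k, h (x * q ^ k) / h x * (V.real (geomCell q x k) / x), ?_, ?_⟩
  · have hlim : ∑' k : ℕ, (q ^ k) ^ ρ * (κ * (q ^ (k + 1) - 1) - κ * (q ^ k - 1)) =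
        κ * ((q - 1) / (1 - q ^ (ρ + 1))) := by
      have hterm : ∀ k : ℕ, (q ^ k) ^ ρ * (κ * (q ^ (k + 1) - 1) - κ * (q ^ k - 1)) =
          κ * (q - 1) * (q ^ (ρ + 1)) ^ k := by
        intro k
        rw [← Real.rpow_natCast (q ^ (ρ + 1)) k, ← Real.rpow_mul hq0.le, ← Real.rpow_natCast q k,
          ← Real.rpow_mul hq0.le, show (ρ + 1) * (k : ℝ) = k * ρ + k by ring,
          Real.rpow_add hq0, pow_succ, Real.rpow_natCast q k]
        ring
      simp only [hterm]
      rw [tsum_mul_left, tsum_geometric_of_lt_one (Real.rpow_nonneg hq0.le _)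
        (Real.rpow_lt_one_of_one_lt_of_neg hq (by linarith)), mul_div_assoc', mul_assoc,
        ← mul_div_assoc', div_eq_mul_inv]
    rw [← hlim]
    refine tendsto_tsum_of_dominated_convergence
      (bound := fun k => (κ + 1) * q * (a * q) ^ k) ?_ ?_ ?_
    · exact (summable_geometric_of_lt_one (by positivity) haq).mul_left _
    · intro k
      have hqk : (1 : ℝ) ≤ q ^ k := one_le_pow₀ hq.le
      have hqk1 : (1 : ℝ) ≤ q ^ (k + 1) := one_le_pow₀ hq.le
      refine Tendsto.mul ?_ ?_
      · refine (hh.ratio (q ^ k) (by positivity)).congr fun x => ?_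
        rw [mul_comm]
      · refine ((hV.tendsto_Ico_mul_div (sub_nonneg.2 hqk1)).sub
          (hV.tendsto_Ico_mul_div (sub_nonneg.2 hqk))).congr' ?_
        filter_upwards [eventually_gt_atTop 0] with x hx
        rw [geomCell, hV.real_Ico (mul_nonneg hx.le (sub_nonneg.2 hqk)), sub_div]
        refine mul_le_mul_of_nonneg_left (sub_le_sub_right ?_ _) hx.le
        exact pow_le_pow_right₀ hq.le (Nat.le_succ k)
    · filter_upwards [hall, eventually_gt_atTop 0, eventually_forall_ge hpos] with x hx h0 h1 k
      have hxk : x ≤ x * q ^ k := le_mul_of_one_le_right h0.le (one_le_pow₀ hq.le)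
      have h2 := h1 x le_rfl
      have h3 := h1 _ hxk
      rw [div_mul_div_comm, Real.norm_of_nonneg (by positivity), div_le_iff₀ (by positivity)]
      refine (hx.1 k).trans (le_of_eq ?_)
      ring
  · filter_upwards [hall, eventually_gt_atTop 0, hpos] with x hx h0 h1
    have e : ∑' k, h (x * q ^ k) / h x * (V.real (geomCell q x k) / x) =
        (∑' k, h (x * q ^ k) * V.real (geomCell q x k)) / (x * h x) := by
      rw [← tsum_div_const]
      refine tsum_congr fun k => ?_
      rw [div_mul_div_comm, mul_comm (h x)]
    have hxp : 0 < x * h x := mul_pos h0 h1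
    rw [e, ← mul_div_assoc, ← mul_div_assoc]
    exact ⟨div_le_div_of_nonneg_right hx.2.2.1 hxp.le, div_le_div_of_nonneg_right hx.2.2.2 hxp.le⟩

lemma tendsto_sub_one_div_one_sub_rpow {σ : ℝ} (hσ : σ < 0) :
    Tendsto (fun q : ℝ => (q - 1) / (1 - q ^ σ)) (𝓝[>] 1) (𝓝 (1 / (-σ))) := by
  have hd : HasDerivAt (fun q : ℝ => q ^ σ) σ 1 := by
    simpa using Real.hasDerivAt_rpow_const (x := 1) (p := σ) (Or.inl one_ne_zero)
  have h1 : Tendsto (slope (fun q : ℝ => q ^ σ) 1) (𝓝[>] 1) (𝓝 σ) :=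
    (hasDerivAt_iff_tendsto_slope.1 hd).mono_left (nhdsWithin_mono _ fun x hx => ne_of_gt hx)
  have h2 := (h1.neg).inv₀ (by linarith)
  rw [one_div]
  refine h2.congr fun q => ?_
  rw [slope_def_field, Real.one_rpow, ← neg_div, inv_div, neg_sub]

lemma HolderRV.eventually_integrable {V : Measure ℝ} {κ ρ r : ℝ} {h : ℝ → ℝ}
    (hV : HasLinearGrowth V κ) (hm : Measurable h) (hh : HolderRV ρ r h) (hr : 0 ≤ r)
    (hρ : ρ < -1) : ∀ᶠ x in atTop, Integrable (fun y => h (x + y)) V := by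
  rcases hh.sign with hs | hs
  · obtain ⟨q, hq, H⟩ := hh.exists_geometric_sandwich hV hm hr hρ hs one_pos
    exact (H q hq le_rfl).1
  · obtain ⟨q, hq, H⟩ := hh.neg.exists_geometric_sandwich hV hm.neg hr hρ
      (hs.mono fun t ht => neg_pos.2 ht) one_pos
    exact (H q hq le_rfl).1.mono fun x hx => by simpa using hx.neg

/-- A form of Karamata's theorem, with Lebesgue measure replaced by a measure of linear growth. -/
theorem HolderRV.tendsto_integral_div {V : Measure ℝ} {κ ρ r : ℝ} {h : ℝ → ℝ}
    (hV : HasLinearGrowth V κ) (hm : Measurable h) (hh : HolderRV ρ r h) (hr : 0 ≤ r)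
    (hρ : ρ < -1) :
    Tendsto (fun x => (∫ y, h (x + y) ∂V) / (x * h x)) atTop (𝓝 (κ * (1 / (-(ρ + 1))))) := by
  wlog hs : ∀ᶠ t in atTop, 0 < h t generalizing h
  · have hs' := hh.sign.resolve_left hs
    have := this hm.neg hh.neg (hs'.mono fun t ht => neg_pos.2 ht)
    refine this.congr fun x => ?_
    simp only [Pi.neg_apply]
    rw [integral_neg, mul_neg, neg_div_neg_eq]
  have hκ := hV.pos
  set L := κ * (1 / (-(ρ + 1))) with hL
  have hL0 : 0 < L := mul_pos hκ (one_div_pos.2 (by linarith))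
  have hlimq : Tendsto (fun q : ℝ => κ * ((q - 1) / (1 - q ^ (ρ + 1)))) (𝓝[>] 1) (𝓝 L) :=
    (tendsto_sub_one_div_one_sub_rpow (by linarith)).const_mul κ
  refine tendsto_order.2 ⟨fun b hb => ?_, fun b hb => ?_⟩
  · have : ∀ᶠ ε in 𝓝[>] (0 : ℝ), b < (1 - ε) * L := by
      have : Tendsto (fun ε : ℝ => (1 - ε) * L) (𝓝[>] 0) (𝓝 ((1 - 0) * L)) :=
        ((tendsto_const_nhds.sub tendsto_id).mul_const L).mono_left nhdsWithin_le_nhds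
      exact this.eventually_const_lt (by simpa using hb)
    obtain ⟨ε, hε, hε0⟩ := (this.and self_mem_nhdsWithin).exists
    obtain ⟨q₀, hq₀, H⟩ := hh.exists_geometric_sandwich hV hm hr hρ hs hε0
    obtain ⟨q, hq1, hq2⟩ := (((hlimq.const_mul (1 - ε)).eventually_const_lt hε).and
      (Ioc_mem_nhdsGT hq₀)).exists
    obtain ⟨-, S, hS, hSx⟩ := H q hq2.1 hq2.2
    filter_upwards [hSx, (hS.const_mul (1 - ε)).eventually_const_lt hq1] with x h1 h2
    exact h2.trans_le h1.1
  · have : ∀ᶠ ε in 𝓝[>] (0 : ℝ), (1 + ε) * L < b := by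
      have : Tendsto (fun ε : ℝ => (1 + ε) * L) (𝓝[>] 0) (𝓝 ((1 + 0) * L)) :=
        ((tendsto_const_nhds.add tendsto_id).mul_const L).mono_left nhdsWithin_le_nhds
      exact this.eventually_lt_const (by simpa using hb)
    obtain ⟨ε, hε, hε0⟩ := (this.and self_mem_nhdsWithin).exists
    obtain ⟨q₀, hq₀, H⟩ := hh.exists_geometric_sandwich hV hm hr hρ hs hε0
    obtain ⟨q, hq1, hq2⟩ := (((hlimq.const_mul (1 + ε)).eventually_lt_const hε).and
      (Ioc_mem_nhdsGT hq₀)).exists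
    obtain ⟨-, S, hS, hSx⟩ := H q hq2.1 hq2.2
    filter_upwards [hSx, (hS.const_mul (1 + ε)).eventually_lt_const hq1] with x h1 h2
    exact h1.2.trans_lt h2

/-- Convolution with a measure of linear growth raises the index by one and keeps the Hölder
condition: translating the argument to the right only makes the relative increment smaller. -/
theorem HolderRV.integral {V : Measure ℝ} {κ ρ r : ℝ} {h : ℝ → ℝ}
    (hV : HasLinearGrowth V κ) (hm : Measurable h) (hh : HolderRV ρ r h) (hr : 0 ≤ r)
    (hρ : ρ < -1) : HolderRV (ρ + 1) r (fun x => ∫ y, h (x + y) ∂V) := by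
  wlog hs : ∀ᶠ t in atTop, 0 < h t generalizing h
  · have hs' := hh.sign.resolve_left hs
    have := (this hm.neg hh.neg (hs'.mono fun t ht => neg_pos.2 ht)).neg
    simpa [integral_neg] using this
  have hκ := hV.pos
  have hlim := hh.tendsto_integral_div hV hm hr hρ
  have hL0 : 0 < κ * (1 / (-(ρ + 1))) := mul_pos hκ (one_div_pos.2 (by linarith))
  have hHpos : ∀ᶠ x in atTop, 0 < ∫ y, h (x + y) ∂V := by
    filter_upwards [hlim.eventually_const_lt hL0, hs, eventually_gt_atTop 0] with x h1 h2 h3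
    have h4 : 0 < x * h x := mul_pos h3 h2
    exact (div_pos_iff_of_pos_right h4).1 h1
  refine ⟨Or.inl hHpos, fun l hl => ?_, fun ε hε => ?_⟩
  · have hl' : Tendsto (fun x : ℝ => l * x) atTop atTop := tendsto_id.const_mul_atTop hl
    have h1 := (((hlim.comp hl').div hlim hL0.ne').mul_const l).mul (hh.ratio l hl)
    rw [div_self hL0.ne', one_mul, mul_comm, ← Real.rpow_add_one hl.ne'] at h1
    refine h1.congr' ?_
    filter_upwards [hs, hl'.eventually hs, hHpos, eventually_gt_atTop 0] with x h2 h3 h4 h5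
    simp only [Function.comp, Pi.div_apply]
    field_simp
  · obtain ⟨δ, hδ, H⟩ := hh.holder ε hε
    refine ⟨min δ (1 / 2), by positivity, ?_⟩
    have hint := eventually_forall_ge (hh.eventually_integrable hV hm hr hρ)
    filter_upwards [eventually_forall_ge H, eventually_forall_ge hs, eventually_gt_atTop 0,
      hint, (tendsto_id.atTop_div_const (show (0 : ℝ) < 2 by norm_num)).eventually hint, hHpos]
      with t h1 h2 ht hi1 hi2 hH x hx
    have hx1 := hx.trans (min_le_left _ _)
    have hx2 := (abs_le.1 (hx.trans (min_le_right _ _))).2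
    have hi3 := hi2 (t * (1 - x)) (by simp only [id]; nlinarith)
    rw [← integral_sub hi3 (hi1 t le_rfl), abs_of_pos hH, ← integral_const_mul]
    refine (abs_integral_le_integral_abs).trans ?_
    refine integral_mono_ae (hi3.sub (hi1 t le_rfl)).abs ((hi1 t le_rfl).const_mul _) ?_
    filter_upwards [hV.ae_nonneg] with y hy
    have hty : 0 < t + y := by linarith
    have hfrac : |x * (t / (t + y))| ≤ |x| := by
      rw [abs_mul, abs_of_pos (div_pos ht hty)]
      refine mul_le_of_le_one_right (abs_nonneg _) ?_
      rw [div_le_one hty]; linarith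
    have h3 := h1 (t + y) (by linarith) (x * (t / (t + y))) (hfrac.trans hx1)
    rw [show (t + y) * (1 - x * (t / (t + y))) = t * (1 - x) + y by field_simp; ring,
      abs_of_pos (h2 (t + y) (by linarith))] at h3
    refine h3.trans ?_
    refine mul_le_mul_of_nonneg_right ?_ (h2 (t + y) (by linarith)).le
    exact mul_le_mul_of_nonneg_left (Real.rpow_le_rpow (abs_nonneg _) hfrac hr) hε.le

/-! ### Derivatives -/

lemma hasLinearGrowth_volume : HasLinearGrowth (volume.restrict (Ici (0 : ℝ))) 1 where
  pos := one_pos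
  Iio_zero := by
    rw [Measure.restrict_apply measurableSet_Iio]
    have : Iio (0 : ℝ) ∩ Ici 0 = ∅ := by ext x; simp
    simp [this]
  finite y := by
    refine ne_top_of_le_ne_top ?_ (Measure.restrict_apply_le _ _)
    simp
  tendsto := by
    refine tendsto_const_nhds.congr' ?_
    filter_upwards [eventually_gt_atTop 0] with y hy
    rw [measureReal_restrict_apply measurableSet_Icc, inter_eq_left.2 Icc_subset_Ici_self]
    simp [hy.le, hy.ne']

lemma measurable_iteratedDeriv {h : ℝ → ℝ} (hm : Measurable h) (k : ℕ) :
    Measurable (iteratedDeriv k h) := by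
  cases k with
  | zero => simpa using hm
  | succ k => rw [iteratedDeriv_succ]; exact measurable_deriv _

lemma tendsto_atTop_of_le_deriv {f f' : ℝ → ℝ} {d : ℝ} (hd : 0 < d)
    (hf : ∀ᶠ t in atTop, HasDerivAt f (f' t) t) (hf' : ∀ᶠ t in atTop, d ≤ f' t) :
    Tendsto f atTop atTop := by
  obtain ⟨T, hT⟩ := eventually_atTop.1 (hf.and hf')
  have hcv : ∀ t, T ≤ t → d * (t - T) ≤ f t - f T := by
    intro t ht
    refine (convex_Ici T).mul_sub_le_image_sub_of_le_deriv
      (fun x hx => (hT x hx).1.continuousAt.continuousWithinAt) (fun x hx => ?_) (fun x hx => ?_)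
      T self_mem_Ici t ht ht
    · exact (hT x (interior_subset hx)).1.differentiableAt.differentiableWithinAt
    · rw [(hT x (interior_subset hx)).1.deriv]; exact (hT x (interior_subset hx)).2
  have hlim : Tendsto (fun t => f T + d * (t - T)) atTop atTop :=
    tendsto_atTop_add_const_left _ _
      ((tendsto_atTop_add_const_right _ (-T) tendsto_id).const_mul_atTop hd)
  refine tendsto_atTop_mono' _ ?_ hlim
  filter_upwards [eventually_ge_atTop T] with t ht
  linarith [hcv t ht]

lemma exists_pos_le_of_iteratedDeriv {h : ℝ → ℝ} {k : ℕ}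
    (hd : ∀ j < k, ∀ᶠ t in atTop,
      HasDerivAt (iteratedDeriv j h) (iteratedDeriv (j + 1) h t) t)
    (hk : ∃ d > 0, ∀ᶠ t in atTop, d ≤ iteratedDeriv k h t) :
    ∃ d > 0, ∀ᶠ t in atTop, d ≤ h t := by
  induction k with
  | zero => simpa using hk
  | succ k ih =>
    refine ih (fun j hj => hd j (by omega)) ⟨1, one_pos, ?_⟩
    obtain ⟨d, hd0, hdk⟩ := hk
    exact (tendsto_atTop_of_le_deriv hd0 (hd k (by omega)) hdk).eventually_ge_atTop 1

/-- If a function vanishes at infinity, so does every derivative that has a limit. -/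
lemma iteratedDeriv_limit_eq_zero {h : ℝ → ℝ} {k : ℕ} {c : ℝ}
    (hd : ∀ j < k, ∀ᶠ t in atTop,
      HasDerivAt (iteratedDeriv j h) (iteratedDeriv (j + 1) h t) t)
    (h0 : Tendsto h atTop (𝓝 0)) (hc : Tendsto (iteratedDeriv k h) atTop (𝓝 c)) : c = 0 := by
  rcases lt_trichotomy c 0 with hneg | hz | hpos
  · have hd' : ∀ j < k, ∀ᶠ t in atTop, HasDerivAt (iteratedDeriv j (-h))
        (iteratedDeriv (j + 1) (-h) t) t := by
      intro j hj
      filter_upwards [hd j hj] with t ht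
      have e : iteratedDeriv j (-h) = -iteratedDeriv j h := by
        ext x; rw [iteratedDeriv_neg]; rfl
      rw [iteratedDeriv_neg, e]
      exact ht.neg
    have hk : ∃ d > 0, ∀ᶠ t in atTop, d ≤ iteratedDeriv k (-h) t := by
      refine ⟨-c / 2, by linarith, ?_⟩
      filter_upwards [hc.eventually_lt_const (show c < c / 2 by linarith)] with t ht
      rw [iteratedDeriv_neg]
      linarith
    obtain ⟨d, hd0, hdk⟩ := exists_pos_le_of_iteratedDeriv hd' hk
    have := ge_of_tendsto h0.neg hdk
    linarith
  · exact hz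
  · have hk : ∃ d > 0, ∀ᶠ t in atTop, d ≤ iteratedDeriv k h t := by
      refine ⟨c / 2, by linarith, ?_⟩
      filter_upwards [hc.eventually_const_lt (show c / 2 < c by linarith)] with t ht using ht.le
    obtain ⟨d, hd0, hdk⟩ := exists_pos_le_of_iteratedDeriv hd hk
    have := ge_of_tendsto h0 hdk
    linarith

namespace HolderRV

variable {ρ r : ℝ} {f f' h : ℝ → ℝ}

lemma exists_tendsto_of_hasDerivAt (hh : HolderRV ρ r f') (hm : Measurable f') (hr : 0 ≤ r)
    (hρ : ρ < -1) (hd : ∀ᶠ t in atTop, HasDerivAt f (f' t) t) :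
    ∃ c, Tendsto f atTop (𝓝 c) := by
  obtain ⟨x, hx1, hx2⟩ := ((hh.eventually_integrable hasLinearGrowth_volume hm hr hρ).and
    (eventually_forall_ge hd)).exists
  have hlim := tendsto_limUnder_of_hasDerivAt_of_integrableOn_Ioi (a := 0)
    (f := fun y => f (x + y)) (f' := fun y => f' (x + y))
    (fun y hy => HasDerivAt.comp_const_add x y (hx2 (x + y) (by
      have : (0 : ℝ) < y := hy
      linarith)))
    (IntegrableOn.mono_set hx1 Ioi_subset_Ici_self)
  refine ⟨_, (hlim.comp (tendsto_atTop_add_const_right _ (-x) tendsto_id)).congr fun z => ?_⟩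
  simp

/-- A primitive that vanishes at infinity is, up to sign, the convolution of the derivative with
Lebesgue measure on the half-line. -/
lemma of_hasDerivAt (hh : HolderRV ρ r f') (hm : Measurable f') (hr : 0 ≤ r)
    (hρ : ρ < -1) (hd : ∀ᶠ t in atTop, HasDerivAt f (f' t) t) (h0 : Tendsto f atTop (𝓝 0)) :
    HolderRV (ρ + 1) r f := by
  refine (hh.integral hasLinearGrowth_volume hm hr hρ).neg.congr ?_
  filter_upwards [hh.eventually_integrable hasLinearGrowth_volume hm hr hρ,
    eventually_forall_ge hd] with x hx1 hx2
  have := integral_Ioi_of_hasDerivAt_of_tendsto' (a := 0) (m := 0)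
    (f := fun y => f (x + y)) (f' := fun y => f' (x + y))
    (fun y hy => HasDerivAt.comp_const_add x y (hx2 (x + y) (by
      have : (0 : ℝ) ≤ y := hy
      linarith)))
    (IntegrableOn.mono_set hx1 Ioi_subset_Ici_self)
    (h0.comp (tendsto_atTop_add_const_left _ x tendsto_id))
  rw [integral_Ici_eq_integral_Ioi, this]
  simp

/-- All lower derivatives inherit regular variation from the top one. -/
lemma iteratedDeriv_of_le {α : ℝ} (hα : 1 < α) (hm : Measurable h) (hr : 0 ≤ r)
    (h0 : Tendsto h atTop (𝓝 0)) {m : ℕ}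
    (hd : ∀ k < m, ∀ᶠ t in atTop,
      HasDerivAt (iteratedDeriv k h) (iteratedDeriv (k + 1) h t) t)
    (hh : HolderRV (-α - m) r (iteratedDeriv m h)) {k : ℕ} (hk : k ≤ m) :
    HolderRV (-α - k) r (iteratedDeriv k h) := by
  induction hk using Nat.decreasingInduction with
  | self => exact hh
  | of_succ k hk ih =>
    have hmk := measurable_iteratedDeriv hm (k + 1)
    have hidx : -α - ((k + 1 : ℕ) : ℝ) < -1 := by
      have : (0 : ℝ) ≤ k := k.cast_nonneg
      push_cast
      linarith
    obtain ⟨c, hc⟩ := ih.exists_tendsto_of_hasDerivAt hmk hr hidx (hd k hk)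
    obtain rfl := iteratedDeriv_limit_eq_zero (fun j hj => hd j (by omega)) h0 hc
    have := ih.of_hasDerivAt hmk hr hidx (hd k hk) hc
    convert this using 1
    push_cast
    ring

lemma eventually_abs_add_le (hh : HolderRV ρ r h) (hr : 0 ≤ r) :
    ∀ᶠ x in atTop, ∀ z ∈ Metric.ball x 1, ∀ y, 0 ≤ y → |h (z + y)| ≤ 2 * |h (x + y)| := by
  obtain ⟨δ, hδ, H⟩ := hh.exists_abs_sub_le hr one_pos
  filter_upwards [eventually_forall_ge H, eventually_gt_atTop 0, eventually_ge_atTop (1 / δ)]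
    with x h1 hx hxδ z hz y hy
  have hxy : 0 < x + y := by linarith
  rw [Metric.mem_ball, Real.dist_eq] at hz
  have h2 := h1 (x + y) (by linarith) ((x - z) / (x + y)) (by
    rw [abs_div, abs_of_pos hxy, div_le_iff₀ hxy, abs_sub_comm]
    rw [div_le_iff₀ hδ] at hxδ
    nlinarith)
  rw [show (x + y) * (1 - (x - z) / (x + y)) = z + y by field_simp; ring, one_mul] at h2
  have h3 : |h (z + y)| ≤ |h (z + y) - h (x + y)| + |h (x + y)| := by
    simpa using abs_add_le (h (z + y) - h (x + y)) (h (x + y))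
  linarith

end HolderRV

section Convolution

variable {V : Measure ℝ} {κ ρ r : ℝ} {f f' : ℝ → ℝ}

lemma HolderRV.eventually_hasDerivAt_integral (hV : HasLinearGrowth V κ)
    (hh : HolderRV ρ r f') (hm : Measurable f) (hm' : Measurable f') (hr : 0 ≤ r) (hρ : ρ < -1)
    (hd : ∀ᶠ t in atTop, HasDerivAt f (f' t) t)
    (hi : ∀ᶠ x in atTop, Integrable (fun y => f (x + y)) V) :
    ∀ᶠ x in atTop, HasDerivAt (fun x => ∫ y, f (x + y) ∂V) (∫ y, f' (x + y) ∂V) x := by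
  have hshift : Tendsto (fun x : ℝ => x - 1) atTop atTop :=
    tendsto_atTop_add_const_right _ _ tendsto_id
  filter_upwards [hh.eventually_abs_add_le hr, hshift.eventually (eventually_forall_ge hd), hi,
    hh.eventually_integrable hV hm' hr hρ] with x h1 h2 h3 h4
  refine (hasDerivAt_integral_of_dominated_loc_of_deriv_le
    (F := fun x y => f (x + y)) (F' := fun x y => f' (x + y))
    (bound := fun y => 2 * |f' (x + y)|) (Metric.ball_mem_nhds x one_pos)
    (Eventually.of_forall fun z => (hm.comp (measurable_const_add z)).aestronglyMeasurable) h3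
    (hm'.comp (measurable_const_add x)).aestronglyMeasurable ?_ (h4.abs.const_mul 2) ?_).2
  · filter_upwards [hV.ae_nonneg] with y hy z hz using h1 z hz y hy
  · filter_upwards [hV.ae_nonneg] with y hy z hz
    refine HasDerivAt.comp_add_const z y (h2 (z + y) ?_)
    rw [Metric.mem_ball, Real.dist_eq] at hz
    linarith [(abs_lt.1 hz).1]

lemma HolderRV.eventually_continuousAt_integral (hV : HasLinearGrowth V κ)
    (hh : HolderRV ρ r f) (hm : Measurable f) (hr : 0 ≤ r) (hρ : ρ < -1)
    (hc : ∀ᶠ t in atTop, ContinuousAt f t) :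
    ∀ᶠ x in atTop, ContinuousAt (fun x => ∫ y, f (x + y) ∂V) x := by
  filter_upwards [hh.eventually_abs_add_le hr, eventually_forall_ge hc,
    hh.eventually_integrable hV hm hr hρ] with x h1 h2 h4
  refine continuousAt_of_dominated (bound := fun y => 2 * |f (x + y)|)
    (Eventually.of_forall fun z => (hm.comp (measurable_const_add z)).aestronglyMeasurable)
    ?_ (h4.abs.const_mul 2) ?_
  · filter_upwards [Metric.ball_mem_nhds x one_pos] with z hz
    filter_upwards [hV.ae_nonneg] with y hy using h1 z hz y hy
  · filter_upwards [hV.ae_nonneg] with y hy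
    exact (h2 (x + y) (by linarith)).comp (f := fun z => z + y)
      (continuous_add_const y).continuousAt

end Convolution

/-! ### Smooth variation in terms of the Hölder condition -/

lemma abs_relIncr {r t x : ℝ} {h : ℝ → ℝ} (hx : x ≠ 0) :
    |relIncr r t x h| = |h (t * (1 - x)) - h t| / (|x| ^ r * |h t|) := by
  have hs : |Real.sign x| = 1 := by
    rcases Real.sign_apply_eq_of_ne_zero x hx with h | h <;> simp [h]
  rw [relIncr, abs_div, abs_mul, abs_mul, hs, one_mul,
    abs_of_nonneg (Real.rpow_nonneg (abs_nonneg x) r)]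

lemma SmoothlyVarying.holderRV {ρ ω : ℝ} {h : ℝ → ℝ} (hh : SmoothlyVarying ρ ω h) :
    HolderRV (ρ - ⌊ω⌋₊) (ω - ⌊ω⌋₊) (iteratedDeriv ⌊ω⌋₊ h) where
  sign := hh.1.2.2.2.1
  ratio := hh.1.2.2.2.2
  holder ε hε := by
    have h1 := hh.2.eventually_lt_const (show (0 : ℝ≥0∞) < ENNReal.ofReal ε by simpa using hε)
    obtain ⟨δ, h2, hδ⟩ := (h1.and self_mem_nhdsWithin).exists
    refine ⟨δ, hδ, ?_⟩
    have hne : ∀ᶠ t in atTop, iteratedDeriv ⌊ω⌋₊ h t ≠ 0 := by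
      rcases hh.1.2.2.2.1 with hs | hs
      · exact hs.mono fun t ht => ht.ne'
      · exact hs.mono fun t ht => ht.ne
    filter_upwards [eventually_lt_of_limsup_lt h2, hne] with t ht hnet x hx
    rcases eq_or_ne x 0 with rfl | hx0
    · simp only [sub_zero, mul_one, sub_self, abs_zero]
      exact mul_nonneg (mul_nonneg hε.le (Real.rpow_nonneg le_rfl _)) (abs_nonneg _)
    · have h3 := (le_iSup₂ (f := fun (x : ℝ) (_ : 0 < |x| ∧ |x| ≤ δ) =>
        ENNReal.ofReal |relIncr (ω - ⌊ω⌋₊) t x (iteratedDeriv ⌊ω⌋₊ h)|) x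
        ⟨abs_pos.2 hx0, hx⟩).trans ht.le
      rw [ENNReal.ofReal_le_ofReal_iff hε.le, abs_relIncr hx0, div_le_iff₀ (mul_pos
        (Real.rpow_pos_of_pos (abs_pos.2 hx0) _) (abs_pos.2 hnet))] at h3
      rwa [mul_assoc]

lemma HolderRV.tendsto_limsup_relIncr {ρ r : ℝ} {h : ℝ → ℝ} (hh : HolderRV ρ r h) :
    Tendsto (fun δ : ℝ => limsup (fun t : ℝ => ⨆ (x : ℝ) (_ : 0 < |x| ∧ |x| ≤ δ),
      ENNReal.ofReal |relIncr r t x h|) atTop) (𝓝[>] 0) (𝓝 0) := by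
  refine ENNReal.tendsto_nhds_zero.2 fun e he => ?_
  obtain ⟨ε, hε0, hεe⟩ := ENNReal.lt_iff_exists_nnreal_btwn.1 he
  obtain ⟨δ₀, hδ₀, H⟩ := hh.holder ε (by exact_mod_cast hε0)
  have hne : ∀ᶠ t in atTop, h t ≠ 0 := by
    rcases hh.sign with hs | hs
    · exact hs.mono fun t ht => ht.ne'
    · exact hs.mono fun t ht => ht.ne
  filter_upwards [Ioc_mem_nhdsGT hδ₀] with δ hδ
  refine (limsup_le_of_le (a := (ε : ℝ≥0∞)) (by isBoundedDefault) ?_).trans hεe.le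
  filter_upwards [H, hne] with t ht hnet
  refine iSup₂_le fun x hx => ?_
  rw [← ENNReal.ofReal_coe_nnreal]
  refine ENNReal.ofReal_le_ofReal ?_
  rw [abs_relIncr (abs_pos.1 hx.1), div_le_iff₀ (mul_pos
    (Real.rpow_pos_of_pos hx.1 _) (abs_pos.2 hnet)), ← mul_assoc]
  exact ht x (hx.2.trans hδ.2)

lemma SmoothlyVaryingNat.eventually_hasDerivAt {ρ : ℝ} {m : ℕ} {h : ℝ → ℝ}
    (hh : SmoothlyVaryingNat ρ m h) {k : ℕ} (hk : k < m) :
    ∀ᶠ t in atTop, HasDerivAt (iteratedDeriv k h) (iteratedDeriv (k + 1) h t) t := by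
  obtain ⟨T, hT⟩ := hh.2.1
  filter_upwards [eventually_gt_atTop T] with t ht
  have h1 := hT.differentiableOn_iteratedDerivWithin (m := k) (by exact_mod_cast hk)
    isOpen_Ioi.uniqueDiffOn
  have h2 := (h1.congr fun x hx => (iteratedDerivWithin_of_isOpen isOpen_Ioi hx).symm)
  rw [iteratedDeriv_succ]
  exact (h2.differentiableAt (Ioi_mem_nhds ht)).hasDerivAt

lemma SmoothlyVaryingNat.eventually_continuousAt {ρ : ℝ} {m : ℕ} {h : ℝ → ℝ}
    (hh : SmoothlyVaryingNat ρ m h) : ∀ᶠ t in atTop, ContinuousAt (iteratedDeriv m h) t := by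
  obtain ⟨T, hT⟩ := hh.2.1
  filter_upwards [eventually_gt_atTop T] with t ht
  have h1 := hT.continuousOn_iteratedDerivWithin (m := m) le_rfl isOpen_Ioi.uniqueDiffOn
  have h2 := (h1.congr fun x hx => (iteratedDerivWithin_of_isOpen isOpen_Ioi hx).symm)
  exact h2.continuousAt (Ioi_mem_nhds ht)

/-- Convolution with a measure of linear growth preserves smooth variation and its order, and
raises the index by one. -/
theorem SmoothlyVarying.of_eventually_eq_integral {V : Measure ℝ} {κ α ω : ℝ} {h g : ℝ → ℝ}
    (hV : HasLinearGrowth V κ) (hα : 1 < α) (hω : 0 ≤ ω) (hh : SmoothlyVarying (-α) ω h)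
    (h0 : Tendsto h atTop (𝓝 0)) (hg : Measurable g)
    (hgh : ∀ᶠ x in atTop, g x = ∫ y, h (x + y) ∂V) :
    SmoothlyVarying (-α + 1) ω g ∧
      Tendsto (fun x => g x / (x * h x)) atTop (𝓝 (κ * (1 / (α - 1)))) := by
  set m := ⌊ω⌋₊ with hm
  have hr : 0 ≤ ω - m := sub_nonneg.2 (Nat.floor_le hω)
  have hhm : Measurable h := hh.1.1
  have hdh : ∀ k < m, ∀ᶠ t in atTop,
      HasDerivAt (iteratedDeriv k h) (iteratedDeriv (k + 1) h t) t :=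
    fun k hk => hh.1.eventually_hasDerivAt hk
  have hRV : ∀ k ≤ m, HolderRV (-α - k) (ω - m) (iteratedDeriv k h) :=
    fun k hk => HolderRV.iteratedDeriv_of_le hα hhm hr h0 hdh hh.holderRV hk
  have hidx : ∀ k : ℕ, -α - (k : ℝ) < -1 := fun k => by
    have : (0 : ℝ) ≤ k := k.cast_nonneg
    linarith
  have hder : ∀ k < m, ∀ᶠ x in atTop, HasDerivAt (fun x => ∫ y, iteratedDeriv k h (x + y) ∂V)
      (∫ y, iteratedDeriv (k + 1) h (x + y) ∂V) x := fun k hk =>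
    (hRV (k + 1) hk).eventually_hasDerivAt_integral hV (measurable_iteratedDeriv hhm k)
      (measurable_iteratedDeriv hhm (k + 1)) hr (hidx _) (hdh k hk)
      ((hRV k hk.le).eventually_integrable hV (measurable_iteratedDeriv hhm k) hr (hidx k))
  have hgk : ∀ k ≤ m, ∀ᶠ x in atTop, iteratedDeriv k g x = ∫ y, iteratedDeriv k h (x + y) ∂V := by
    intro k hk
    induction k with
    | zero => simpa using hgh
    | succ k ih =>
      filter_upwards [eventually_eventuallyEq_nhds_of_atTop (ih (by omega)), hder k hk]
        with x h1 h2
      rw [iteratedDeriv_succ]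
      exact (h2.congr_of_eventuallyEq h1).deriv
  have hgdiff : ∀ k < m, ∀ᶠ x in atTop, DifferentiableAt ℝ (iteratedDeriv k g) x := by
    intro k hk
    filter_upwards [eventually_eventuallyEq_nhds_of_atTop (hgk k hk.le), hder k hk] with x h1 h2
    exact (h2.congr_of_eventuallyEq h1).differentiableAt
  have hgcont : ∀ k ≤ m, ∀ᶠ x in atTop, ContinuousAt (iteratedDeriv k g) x := by
    intro k hk
    rcases hk.lt_or_eq with hlt | rfl
    · exact (hgdiff k hlt).mono fun x hx => hx.continuousAt
    · filter_upwards [eventually_eventuallyEq_nhds_of_atTop (hgk m le_rfl),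
        (hRV m le_rfl).eventually_continuousAt_integral hV (measurable_iteratedDeriv hhm m) hr
          (hidx m) hh.1.eventually_continuousAt] with x h1 h2
      exact h2.congr (EventuallyEq.symm h1)
  have hsm : ∃ T : ℝ, ContDiffOn ℝ m g (Ioi T) := by
    have h1 : ∀ᶠ x in atTop, ∀ k ∈ Finset.range (m + 1), ContinuousAt (iteratedDeriv k g) x :=
      (eventually_all_finset _).2 fun k hk => hgcont k (by simpa [Nat.lt_succ_iff] using hk)
    have h2 : ∀ᶠ x in atTop, ∀ k ∈ Finset.range m, DifferentiableAt ℝ (iteratedDeriv k g) x :=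
      (eventually_all_finset _).2 fun k hk => hgdiff k (by simpa using hk)
    obtain ⟨T, hT⟩ := eventually_atTop.1 (h1.and h2)
    refine ⟨T, contDiffOn_of_continuousOn_differentiableOn_deriv (n := (m : ℕ∞))
      (fun k hk => ?_) (fun k hk => ?_)⟩
    · have hk' : k ≤ m := by exact_mod_cast hk
      refine ContinuousOn.congr (f := iteratedDeriv k g) (fun x hx => ?_)
        (fun x hx => iteratedDerivWithin_of_isOpen isOpen_Ioi hx)
      exact ((hT x (le_of_lt hx)).1 k (by simpa [Nat.lt_succ_iff] using hk')).continuousWithinAt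
    · have hk' : k < m := by exact_mod_cast hk
      refine DifferentiableOn.congr (f := iteratedDeriv k g) (fun x hx => ?_)
        (fun x hx => iteratedDerivWithin_of_isOpen isOpen_Ioi hx)
      exact ((hT x (le_of_lt hx)).2 k (by simpa using hk')).differentiableWithinAt
  have hRVg : HolderRV (-α + 1 - m) (ω - m) (iteratedDeriv m g) := by
    have := ((hRV m le_rfl).integral hV (measurable_iteratedDeriv hhm m) hr (hidx m)).congr
      (hgk m le_rfl)
    convert this using 1
    ring
  refine ⟨⟨⟨hg, hsm, measurable_iteratedDeriv hg m, hRVg.sign, hRVg.ratio⟩,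
    hRVg.tendsto_limsup_relIncr⟩, ?_⟩
  have h1 : HolderRV (-α) (ω - m) h := by simpa using hRV 0 (Nat.zero_le m)
  have h2 := h1.tendsto_integral_div hV hhm hr (by linarith)
  rw [show -(-α + 1) = α - 1 by ring] at h2
  refine h2.congr' ?_
  filter_upwards [hgh] with x hx
  rw [hx]

/-! ### The ladder height tail as a convolution -/

section Reflection

variable {F : Measure ℝ} [IsProbabilityMeasure F]

/-- The occupation measure of the walk before its first ascent, reflected to the positive
half-line, is the renewal measure of the reflected descending ladder heights, so it grows linearly
at a rate inverse to their mean. -/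
theorem hasLinearGrowth_occupation (hint : Integrable (fun x : ℝ => x) F)
    (hmean : ∫ x, x ∂F < 0) :
    HasLinearGrowth ((occupation F).map fun u => -u) (1 / -∫ x, x ∂hitLaw F (Iic 0)) := by
  set f := hitLaw F (Iic 0) with hf
  have h1 : f univ = 1 := hitLaw_Iic_univ hint hmean
  have hμ : 0 < -∫ x, x ∂f := neg_pos.2 (integral_hitLaw_Iic_neg hint hmean)
  have hfp : IsProbabilityMeasure f := ⟨h1⟩
  have hfG : IsProbabilityMeasure (f.map fun u => -u) :=
    Measure.isProbabilityMeasure_map measurable_neg.aemeasurable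
  have hf0 : ∀ᵐ v ∂f, 0 ≤ -v := by
    have : ∀ᵐ v ∂f, v ∉ Ioi (0 : ℝ) := measure_eq_zero_iff_ae_notMem.1 (hitLaw_Iic_Ioi F)
    filter_upwards [this] with v hv
    rw [mem_Ioi, not_lt] at hv
    linarith
  have hpre : ∀ y : ℝ, (fun u : ℝ => -u) ⁻¹' Icc 0 y = Icc (-y) 0 := fun y => by
    ext u; simp only [mem_preimage, mem_Icc]; constructor <;> intro h <;>
      constructor <;> linarith [h.1, h.2]
  have hVIcc : ∀ y : ℝ, ((occupation F).map fun u => -u) (Icc 0 y) = occupation F (Icc (-y) 0) :=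
    fun y => by rw [Measure.map_apply measurable_neg measurableSet_Icc, hpre]
  have hG : ∀ z : ℝ, (f.map fun u => -u) (Ioi z) = f (Iio (-z)) := fun z => by
    rw [Measure.map_apply measurable_neg measurableSet_Ioi]
    congr 1
    ext u; simp only [mem_preimage, mem_Ioi, mem_Iio]; constructor <;> intro h <;> linarith
  have hover : ∀ y : ℝ, ∫⁻ v in Icc 0 y, (f.map fun u => -u) (Ioi (y - v))
      ∂((occupation F).map fun u => -u) = ∫⁻ u in Icc (-y) 0, f (Iio (-y - u)) ∂occupation F := by
    intro y
    rw [Measure.restrict_map measurable_neg measurableSet_Icc, hpre, lintegral_map _ measurable_neg]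
    · refine lintegral_congr fun u => ?_
      rw [hG]
      congr 2
      ring
    · have : Monotone fun v : ℝ => (f.map fun u => -u) (Ioi (y - v)) := fun a b hab =>
        measure_mono (Ioi_subset_Ioi (by linarith))
      exact this.measurable
  have hmeanG : ∫⁻ x, ENNReal.ofReal x ∂(f.map fun u => -u) = ENNReal.ofReal (-∫ x, x ∂f) := by
    have hi : Integrable (fun x : ℝ => -x) f := (integrable_hitLaw_Iic hint hmean).neg
    rw [lintegral_map ENNReal.measurable_ofReal measurable_neg, ← integral_neg,
      ofReal_integral_eq_lintegral_ofReal hi hf0]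
  have hG0 : (f.map fun u => -u) (Iio 0) = 0 := by
    rw [Measure.map_apply measurable_neg measurableSet_Iio]
    refine measure_mono_null (fun u hu => ?_) (hitLaw_Iic_Ioi F)
    have : -u < 0 := hu
    exact mem_Ioi.2 (by linarith)
  obtain ⟨hfin, hlim⟩ := tendsto_renewal_div (V := (occupation F).map fun u => -u) hμ hmeanG hG0
    (fun y => by rw [hover]; exact lintegral_overshoot_le_one F h1 y)
    (fun y hy hfin => by
      rw [hover]
      exact one_le_lintegral_overshoot F h1 hy (by rwa [← hVIcc]))
  refine ⟨one_div_pos.2 hμ, ?_, hfin, hlim⟩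
  rw [Measure.map_apply measurable_neg measurableSet_Iio]
  refine measure_mono_null (fun u hu => ?_) (occupation_Ioi F)
  have : -u < 0 := hu
  exact mem_Ioi.2 (by linarith)

/-- At its first ascent the walk jumps above `x` from some position `-y` visited before. -/
lemma tail_hitLaw_Ioi {x : ℝ} (hx : 0 ≤ x) :
    tail (hitLaw F (Ioi 0)) x = ∫ y, tail F (x + y) ∂((occupation F).map fun u => -u) := by
  have hmeas : Measurable fun y : ℝ => F (Ioi (x + y)) := by
    have : Antitone fun y : ℝ => F (Ioi (x + y)) := fun a b hab =>
      measure_mono (Ioi_subset_Ioi (by linarith))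
    exact this.measurable
  have h1 : hitLaw F (Ioi 0) (Ioi x) = Measure.conv (occupation F) F (Ioi x) := by
    rw [hitLaw, occupation, sum_conv, Measure.sum_apply _ measurableSet_Ioi,
      Measure.sum_apply _ measurableSet_Ioi]
    refine tsum_congr fun n => ?_
    rw [Measure.restrict_apply measurableSet_Ioi, inter_eq_left.2 (Ioi_subset_Ioi hx)]
  have h2 : Measure.conv (occupation F) F (Ioi x) =
      ∫⁻ y, F (Ioi (x + y)) ∂((occupation F).map fun u => -u) := by
    rw [conv_apply _ _ measurableSet_Ioi, lintegral_map hmeas measurable_neg]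
    refine lintegral_congr fun u => ?_
    congr 1
    ext v
    change x < u + v ↔ x + -u < v
    constructor <;> intro h <;> linarith
  simp only [tail, Measure.real]
  rw [integral_toReal hmeas.aemeasurable (ae_of_all _ fun y => measure_lt_top _ _), h1, h2]

end Reflection

lemma measurable_tail (G : Measure ℝ) : Measurable (tail G) := by
  have : Antitone fun x : ℝ => G (Ioi x) := fun a b hab => measure_mono (Ioi_subset_Ioi hab)
  exact this.measurable.ennreal_toReal

lemma tendsto_tail_atTop (F : Measure ℝ) [IsProbabilityMeasure F] :
    Tendsto (tail F) atTop (𝓝 0) := by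
  have h : Tendsto (fun x => 1 - cdf F x) atTop (𝓝 (1 - 1)) :=
    tendsto_const_nhds.sub (tendsto_cdf_atTop F)
  rw [sub_self] at h
  refine h.congr fun x => ?_
  rw [cdf_eq_real, tail, ← compl_Iic, probReal_compl_eq_one_sub measurableSet_Iic]

end RandomWalkMax

theorem lemma2 {Ω : Type*} [MeasurableSpace Ω] (P : Measure Ω) [IsProbabilityMeasure P]
    (X : ℕ → Ω → ℝ) (hX : ∀ i, Measurable (X i)) (hind : iIndepFun X P)
    (F : Measure ℝ) (hlaw : ∀ i, P.map (X i) = F)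
    (hint : Integrable (fun x : ℝ => x) F) (hmean : ∫ x, x ∂F < 0)
    (α ω : ℝ) (hα : 1 < α) (hω : 0 < ω)
    (hF : RandomWalkMax.SmoothlyVarying (-α) ω (RandomWalkMax.tail F)) :
    RandomWalkMax.SmoothlyVarying (-α + 1) ω
        (RandomWalkMax.tail (RandomWalkMax.ascLadder P X)) ∧
      Integrable (fun x : ℝ => x) (RandomWalkMax.descLadder P X) ∧
      Asymptotics.IsEquivalent atTop
        (RandomWalkMax.tail (RandomWalkMax.ascLadder P X))
        (fun x => -1 / ((α - 1) * ∫ u, u ∂(RandomWalkMax.descLadder P X)) *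
          (x * RandomWalkMax.tail F x)) := by
  have hFp : IsProbabilityMeasure F := by
    rw [← hlaw 0]; exact Measure.isProbabilityMeasure_map (hX 0).aemeasurable
  have hasc : RandomWalkMax.ascLadder P X = RandomWalkMax.hitLaw F (Ioi 0) :=
    RandomWalkMax.stoppedLaw_hittingAfter hX hind hlaw measurableSet_Ioi
  have hdesc : RandomWalkMax.descLadder P X = RandomWalkMax.hitLaw F (Iic 0) :=
    RandomWalkMax.stoppedLaw_hittingAfter hX hind hlaw measurableSet_Iic
  rw [hasc, hdesc]
  obtain ⟨h1, h2⟩ := RandomWalkMax.SmoothlyVarying.of_eventually_eq_integral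
    (RandomWalkMax.hasLinearGrowth_occupation hint hmean) hα hω.le hF
    (RandomWalkMax.tendsto_tail_atTop F)
    (RandomWalkMax.measurable_tail (RandomWalkMax.hitLaw F (Ioi 0)))
    ((eventually_ge_atTop 0).mono fun x hx => RandomWalkMax.tail_hitLaw_Ioi hx)
  refine ⟨h1, RandomWalkMax.integrable_hitLaw_Iic hint hmean, ?_⟩
  have hμ := RandomWalkMax.integral_hitLaw_Iic_neg hint hmean
  set μ := ∫ u, u ∂(RandomWalkMax.hitLaw F (Iic 0))
  have hα1 : α - 1 ≠ 0 := by linarith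
  have hc : 1 / -μ * (1 / (α - 1)) = -1 / ((α - 1) * μ) := by
    field_simp [hμ.ne]
  rw [hc] at h2
  have hc0 : -1 / ((α - 1) * μ) ≠ 0 := div_ne_zero (by norm_num) (mul_ne_zero hα1 hμ.ne)
  -- the limit is nonzero, so the denominators are ultimately nonzero
  have hne : ∀ᶠ x in atTop, x * RandomWalkMax.tail F x ≠ 0 := by
    filter_upwards [h2.eventually_ne hc0] with x hx h0
    exact hx (by rw [h0, div_zero])
  rw [Asymptotics.isEquivalent_iff_tendsto_one (hne.mono fun x hx => mul_ne_zero hc0 hx)]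
  have h3 := h2.div_const (-1 / ((α - 1) * μ))
  rw [div_self hc0] at h3
  refine h3.congr fun x => ?_
  rw [Pi.div_apply, div_div, mul_comm (-1 / ((α - 1) * μ))]
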